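/- Let $n\ge 3$. Let $\mathbb R^{n+2}$ carry a scalar product $(\cdot,\cdot)$ of signature $(n+1,1)$; the points of the conformal space $C^n$ are the isotropic lines $[X]$, $(X,X)=0$, and its hyperspheres are the lines $[B]$ with $(B,B)>0$; the point $[X]$ lies on $[B]$ iff $(X,B)=0$. Let $V^{n-1}\subset C^n$ be a smooth immersed hypersurface, referred to (local, smooth) fields of frames $A_0,A_1,\dots,A_{n+1}$ of $\mathbb R^{n+2}$ whose domains cover $V^{n-1}$, where $[A_0]$ is the point of $V^{n-1}$, the hypersphere $A_n$ is tangent to $V^{n-1}$ at it, and, for $i,j=1,\dots,n-1$, $$(A_0,A_0)=(A_{n+1},A_{n+1})=(A_0,A_i)=(A_{n+1},A_i)=(A_0,A_n)=(A_{n+1},A_n)=(A_i,A_n)=0,$$ $$(A_i,A_j)=g_{ij},\quad (A_n,A_n)=1,\quad (A_0,A_{n+1})=-1 .$$ Write $dA_\xi=\omega_\xi^\eta A_\eta$ and $\omega^i=\omega_0^i$ (a basis of 1-forms on $V^{n-1}$), and define $\lambda_{ij}$ and $\lambda_{ijk}$ by $$\omega_i^n=\lambda_{ij}\omega^j,\qquad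 d\lambda_{ij}-\lambda_{kj}\omega_i^k-\lambda_{ik}\omega_j^k+\lambda_{ij}\omega_0^0+g_{ij}\omega_n^0=\lambda_{ijk}\omega^k .$$ Put $a_{ij}=\lambda_{ij}-\lambda g_{ij}$ with $\lambda=\frac1{n-1}g^{ij}\lambda_{ij}$, let $a^i_j=g^{ik}a_{kj}$ be the Burali-Forti affinor, assume that $(a_{ij})$ is nondegenerate with inverse $(a^{ij})$, and put $$a_{ijk}=\lambda_{ijk}+3\bigl(a_{(ij}g_{k)l}-g_{(ij}a_{k)l}\bigr)\mu^l,\qquad \mu^i=a^{ij}\lambda_j,\quad \lambda_k=\tfrac1{n-1}g^{ij}\lambda_{ijk},$$ where the round brackets denote symmetrization over $i,j,k$. **Theorem 2.** Suppose that at each point $s_1$ is a simple eigenvalue of the affinor $a^i_j$, and that the frames are such that the hypersphere $A_1$ is orthogonal to the corresponding eigendirection $L$ while the hyperspheres $A_p$, $p\ne1$, are tangent to it. Then $V^{n-1}$ is a 1-canal hypersurface for this eigendirection if and only if in these frames the diagonal component $a_{111}$ vanishes identically. Here $V^{n-1}$ is called *1-canal for $L$* if near each of its points it is the envelope of an $(n-2)$-parameter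 family of hyperspheres whose characteristics are tangent to $L$: there are a neighbourhood $U$ of the point in $V^{n-1}$, a smooth family of hyperspheres $[B(t)]$, $t\in T\subset\mathbb R^{n-2}$ open, with $t\mapsto[B(t)]$ an immersion, and a smooth surjective map $\tau:U\to T$ such that for all $y\in U$ the hypersphere $B(\tau(y))$ is tangent to $V^{n-1}$ at $y$ and $\ker d\tau_y=L_y$. -/

import Mathlib

open scoped Manifold ContDiff LinearAlgebra.Projectivization Matrix

noncomputable section

namespace CanalHyp

/-- Polyspherical coordinates `(x⁰, (x¹, …, xⁿ), xⁿ⁺¹)`: the vector space `ℝⁿ⁺²` whose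
projectivization carries the Darboux hyperquadric. -/
abbrev PolyCoord (n : ℕ) : Type := ℝ × EuclideanSpace ℝ (Fin n) × ℝ

/-- The fundamental scalar product of the conformal space, of signature `(n + 1, 1)`:
`(X, Y) = ∑ xⁱ yⁱ - x⁰ yⁿ⁺¹ - xⁿ⁺¹ y⁰`. -/
def form {n : ℕ} (X Y : PolyCoord n) : ℝ :=
  inner ℝ X.2.1 Y.2.1 - X.1 * Y.2.2 - X.2.2 * Y.1

/-- The conformal space `Cⁿ`: the hyperquadric `(X, X) = 0` in `Pⁿ⁺¹`.
A hypersphere of `Cⁿ` is represented, up to a factor, by a vector `B` with `(B, B) > 0`; it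
passes through the point represented by `X` iff `(X, B) = 0`. -/
def ConformalSpace (n : ℕ) : Type :=
  {p : ℙ ℝ (PolyCoord n) // ∀ v ∈ p.submodule, form v v = 0}

/-- The labels `0`, `i = 1, …, n - 1`, `n`, `n + 1` of the elements of a conformal frame. -/
inductive FrameIndex (n : ℕ) : Type
  | zero : FrameIndex n
  | tan (i : Fin (n - 1)) : FrameIndex n
  | normal : FrameIndex n
  | last : FrameIndex n

section Manifold

variable {n : ℕ} {M : Type*} [TopologicalSpace M]
  [ChartedSpace (EuclideanSpace ℝ (Fin (n - 1))) M]

/-- The differential at `x` of a map from the manifold to the space of polyspherical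
coordinates. -/
def diff (Y : M → PolyCoord n) (x : M) : TangentSpace (𝓡 (n - 1)) x →L[ℝ] PolyCoord n :=
  mfderiv (𝓡 (n - 1)) 𝓘(ℝ, PolyCoord n) Y x

/-- The differential at `x` of a real function on the manifold. -/
def diffReal (f : M → ℝ) (x : M) : TangentSpace (𝓡 (n - 1)) x →L[ℝ] ℝ :=
  mfderiv (𝓡 (n - 1)) 𝓘(ℝ, ℝ) f x

/-- `Y` represents, on the open set `O`, the map `X` into the conformal space by smooth
homogeneous coordinates. -/
structure IsSmoothLift (X : M → ConformalSpace n) (Y : M → PolyCoord n) (O : Set M) : Prop where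
  isOpen : IsOpen O
  smooth : ContMDiffOn (𝓡 (n - 1)) 𝓘(ℝ, PolyCoord n) ∞ Y O
  lift : ∀ x ∈ O, ∃ h : Y x ≠ 0, Projectivization.mk ℝ (Y x) h = (X x).1

/-- `X` is a smooth (immersed) hypersurface `Vⁿ⁻¹` of `Cⁿ`: it is smooth, and its differential,
with values in the tangent spaces of the projective space, is injective. -/
def IsHypersurface (X : M → ConformalSpace n) : Prop :=
  ∀ x : M, ∃ (O : Set M) (Y : M → PolyCoord n), x ∈ O ∧ IsSmoothLift X Y O ∧
    ∀ v : TangentSpace (𝓡 (n - 1)) x, diff Y x v ∈ Submodule.span ℝ {Y x} → v = 0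

/-- The hypersphere `B` is tangent to the hypersurface at its point `X x`
(the condition does not depend on the choice of the homogeneous coordinates `Y`). -/
def IsTangentSphereAt (X : M → ConformalSpace n) (B : PolyCoord n) (x : M) : Prop :=
  0 < form B B ∧ ∃ (O : Set M) (Y : M → PolyCoord n), x ∈ O ∧ IsSmoothLift X Y O ∧
    form (Y x) B = 0 ∧ ∀ v : TangentSpace (𝓡 (n - 1)) x, form (diff Y x v) B = 0

/-- `B` is a smooth `r`-parameter family of hyperspheres with parameter domain `T`, the
parameters being essential: `t ↦ [B t]` is an immersion into the projective space. -/
structure IsHypersphereFamily {r : ℕ} (B : EuclideanSpace ℝ (Fin r) → PolyCoord n)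
    (T : Set (EuclideanSpace ℝ (Fin r))) : Prop where
  isOpen : IsOpen T
  smooth : ContDiffOn ℝ ∞ B T
  sphere : ∀ t ∈ T, 0 < form (B t) (B t)
  essential : ∀ t ∈ T, ∀ w, fderiv ℝ B t w ∈ Submodule.span ℝ {B t} → w = 0

/-- On the open set `U` the hypersurface is the envelope of the family `(B t)`, `t ∈ T`, of
hyperspheres, with contact map `τ`: the hypersphere touching it at `y` is `B (τ y)`, and
every member of the family touches it.  The fibres of `τ` are the characteristics, and `L` is
required to consist of the directions tangent to them. -/
structure IsEnvelopeOn {r : ℕ} (X : M → ConformalSpace n)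
    (L : ∀ x : M, Submodule ℝ (TangentSpace (𝓡 (n - 1)) x))
    (B : EuclideanSpace ℝ (Fin r) → PolyCoord n) (T : Set (EuclideanSpace ℝ (Fin r)))
    (τ : M → EuclideanSpace ℝ (Fin r)) (U : Set M) : Prop where
  isOpen : IsOpen U
  smooth : ContMDiffOn (𝓡 (n - 1)) (𝓡 r) ∞ τ U
  image : τ '' U = T
  tangent : ∀ y ∈ U, IsTangentSphereAt X (B (τ y)) y
  characteristic : ∀ y ∈ U, ∀ v : TangentSpace (𝓡 (n - 1)) y,
    mfderiv (𝓡 (n - 1)) (𝓡 r) τ y v = 0 ↔ v ∈ L y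

/-- The hypersurface is (locally) the envelope of an `(n - 2)`-parameter family of hyperspheres
whose characteristics have the direction `L`: it is a 1-canal hypersurface for `L`. -/
def IsOneCanal (X : M → ConformalSpace n)
    (L : ∀ x : M, Submodule ℝ (TangentSpace (𝓡 (n - 1)) x)) : Prop :=
  ∀ x : M, ∃ (U : Set M) (T : Set (EuclideanSpace ℝ (Fin (n - 2))))
    (B : EuclideanSpace ℝ (Fin (n - 2)) → PolyCoord n) (τ : M → EuclideanSpace ℝ (Fin (n - 2))),
    x ∈ U ∧ IsHypersphereFamily B T ∧ IsEnvelopeOn X L B T τ U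

/-- `A` is, on the open set `O`, a smooth field of conformal frames
`A₀, A₁, …, Aₙ₋₁, Aₙ, Aₙ₊₁` associated with the hypersurface `X`: `A₀` is the point of the
hypersurface, `Aₙ` is tangent to the hypersurface, and the `Aᵢ` are orthogonal to it. -/
structure IsFrameField (X : M → ConformalSpace n)
    (A : M → Module.Basis (FrameIndex n) ℝ (PolyCoord n)) (O : Set M) : Prop where
  isOpen : IsOpen O
  smooth : ∀ ξ, ContMDiffOn (𝓡 (n - 1)) 𝓘(ℝ, PolyCoord n) ∞ (fun x => A x ξ) O
  point : ∀ x ∈ O, Projectivization.mk ℝ (A x .zero) ((A x).ne_zero .zero) = (X x).1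
  zero_zero : ∀ x ∈ O, form (A x .zero) (A x .zero) = 0
  last_last : ∀ x ∈ O, form (A x .last) (A x .last) = 0
  last_tan : ∀ x ∈ O, ∀ i, form (A x .last) (A x (.tan i)) = 0
  last_normal : ∀ x ∈ O, form (A x .last) (A x .normal) = 0
  zero_tan : ∀ x ∈ O, ∀ i, form (A x .zero) (A x (.tan i)) = 0
  zero_normal : ∀ x ∈ O, form (A x .zero) (A x .normal) = 0
  tan_normal : ∀ x ∈ O, ∀ i, form (A x (.tan i)) (A x .normal) = 0
  normal_normal : ∀ x ∈ O, form (A x .normal) (A x .normal) = 1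
  zero_last : ∀ x ∈ O, form (A x .zero) (A x .last) = -1
  tangent : ∀ x ∈ O, ∀ v : TangentSpace (𝓡 (n - 1)) x,
    form (diff (fun y => A y .zero) x v) (A x .normal) = 0

variable (A : M → Module.Basis (FrameIndex n) ℝ (PolyCoord n))

/-- The forms `ω_ξ^η` of infinitesimal displacement, `dA_ξ = ω_ξ^η A_η`. -/
def om (ξ η : FrameIndex n) (x : M) : TangentSpace (𝓡 (n - 1)) x →L[ℝ] ℝ :=
  (LinearMap.toContinuousLinearMap ((A x).coord η)).comp (diff (fun y => A y ξ) x)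

/-- The basis forms `ωⁱ = ω₀ⁱ` of the hypersurface, collected in one map. -/
def coframe (x : M) : TangentSpace (𝓡 (n - 1)) x →L[ℝ] (Fin (n - 1) → ℝ) :=
  ContinuousLinearMap.pi fun i => om A .zero (.tan i) x

/-- The tangent frame `e₁, …, eₙ₋₁` dual to the basis forms, `ωⁱ(eⱼ) = δⁱⱼ`. -/
def dualVec (j : Fin (n - 1)) (x : M) : TangentSpace (𝓡 (n - 1)) x :=
  (coframe A x).inverse (Pi.single j 1)

/-- `g_ij = (A_i, A_j)`. -/
def g (x : M) : Matrix (Fin (n - 1)) (Fin (n - 1)) ℝ :=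
  Matrix.of fun i j => form (A x (.tan i)) (A x (.tan j))

/-- `λ_ij`, the coefficients in `ω_i^n = λ_ij ω^j`. -/
def lam (x : M) : Matrix (Fin (n - 1)) (Fin (n - 1)) ℝ :=
  Matrix.of fun i j => om A (.tan i) .normal x (dualVec A j x)

/-- The form `dλ_ij - λ_kj ω_i^k - λ_ik ω_j^k + λ_ij ω_0^0 + g_ij ω_n^0`. -/
def Dlam (i j : Fin (n - 1)) (x : M) : TangentSpace (𝓡 (n - 1)) x →L[ℝ] ℝ :=
  diffReal (fun y => lam A y i j) x
    - ∑ k, lam A x k j • om A (.tan i) (.tan k) x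
    - ∑ k, lam A x i k • om A (.tan j) (.tan k) x
    + lam A x i j • om A .zero .zero x
    + g A x i j • om A .normal .zero x

/-- `λ_ijk`, the coefficients in
`dλ_ij - λ_kj ω_i^k - λ_ik ω_j^k + λ_ij ω_0^0 + g_ij ω_n^0 = λ_ijk ω^k`. -/
def lam3 (x : M) (i j k : Fin (n - 1)) : ℝ := Dlam A i j x (dualVec A k x)

/-- `λ = (1 / (n - 1)) g^ij λ_ij`. -/
def lamMean (x : M) : ℝ := 1 / ((n : ℝ) - 1) * ∑ i, ∑ j, (g A x)⁻¹ i j * lam A x i j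

/-- The tensor `a_ij = λ_ij - λ g_ij`. -/
def a2 (x : M) : Matrix (Fin (n - 1)) (Fin (n - 1)) ℝ := lam A x - lamMean A x • g A x

/-- `λ_k = (1 / (n - 1)) g^ij λ_ijk`. -/
def lamVec (x : M) (k : Fin (n - 1)) : ℝ :=
  1 / ((n : ℝ) - 1) * ∑ i, ∑ j, (g A x)⁻¹ i j * lam3 A x i j k

/-- `μ^i = a^ij λ_j`, where `a^ij` is inverse to the (nondegenerate) tensor `a_ij`. -/
def mu (x : M) (i : Fin (n - 1)) : ℝ := ∑ j, (a2 A x)⁻¹ i j * lamVec A x j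

/-- The tensor `a_ijk = λ_ijk + 3 (a_(ij g_k)l - g_(ij a_k)l) μ^l`, defined when `a_ij` is
nondegenerate; the round brackets are symmetrization over `i, j, k`, which for a product of two
symmetric tensors is one third of the cyclic sum. -/
def a3 (x : M) (i j k : Fin (n - 1)) : ℝ :=
  lam3 A x i j k + ∑ l,
    ((a2 A x i j * g A x k l + a2 A x j k * g A x i l + a2 A x k i * g A x j l)
      - (g A x i j * a2 A x k l + g A x j k * a2 A x i l + g A x k i * a2 A x j l)) * mu A x l

/-- The affinor of Burali-Forti `a^i_j = g^ik a_kj`. -/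
def affinor (x : M) : Matrix (Fin (n - 1)) (Fin (n - 1)) ℝ := (g A x)⁻¹ * a2 A x

/-- The tangent vectors `ξ` with `a^i_j ξ^j = s ξ^i`, where `ξ^i = ω^i(ξ)`. -/
def eigendirection (x : M) (s : ℝ) : Submodule ℝ (TangentSpace (𝓡 (n - 1)) x) :=
  (Module.End.eigenspace (Matrix.toLin' (affinor A x)) s).comap
    (coframe A x : TangentSpace (𝓡 (n - 1)) x →ₗ[ℝ] (Fin (n - 1) → ℝ))

/-- The frame at `x` is adapted to the direction `L`, its element with label `i₁` playing the
distinguished role: the hypersphere `A_i₁` is orthogonal to `L` (the displacements `dA₀` along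
`L` are normal to it, that is, combinations of `A₀` and `A_i₁`), and the other `A_p` are
tangent to `L`. -/
def IsAdaptedAt (x : M) (L : Submodule ℝ (TangentSpace (𝓡 (n - 1)) x))
    (i₁ : Fin (n - 1)) : Prop :=
  ∀ v ∈ L, diff (fun y => A y .zero) x v ∈ Submodule.span ℝ {A x .zero, A x (.tan i₁)} ∧
    ∀ p, p ≠ i₁ → form (diff (fun y => A y .zero) x v) (A x (.tan p)) = 0

end Manifold

end CanalHyp

end

open CanalHyp

noncomputable section

namespace CanalHyp

/-! ### The scalar product and its nondegeneracy -/

section Form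

variable {n : ℕ}

/-! The proof runs through one tangent hypersphere, the curvature sphere C = A_n + κ A_0 with κ =
λ_11 / g_11. In an adapted frame λ_k1 = κ g_k1, so (dC(v), A_j) = -(λ v)_j + κ (g v)_j, which
vanishes for all j exactly when v lies in L (`IsPrincipalAt`). The products of dC with A_0 and A_n
vanish identically. Hence ker dC ⊆ L, and the only obstruction to dC = 0 along L is (dC, A_{n+1}) =
-(dκ + κ ω_0^0 + ω_n^0).

This obstruction is a_111. Since a_1l is proportional to g_1l, the correction terms in a_111 cancel
and a_111 = λ_111; differentiating λ_11 = κ g_11 then gives a_111 = -g_11 (dC(e_1), A_{n+1})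
(`a3_eq`). So a_111 = 0 at a point iff C is stationary along L there (`a3_eq_zero_iff`).

If V is 1-canal, the enveloping spheres B ∘ τ are tangent and stationary along L. Differentiating (B
∘ τ, A_1) = 0 forces B ∘ τ = c C (`eq_smul_curvatureSphere`). Pairing the derivative of this
identity with A_n gives dc = 0 along L, hence dC = 0 there, because c ≠ 0.

Conversely, if C is stationary along L on a whole frame domain, then ker dC = L has dimension one
everywhere, and the constant rank theorem (`exists_factorization_of_finrank_ker_eq_one`) writes C
locally as B ∘ τ with τ a submersion whose kernel is L. The family B is the required one
(`exists_envelope`). -/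

theorem form_comm (X Y : PolyCoord n) : form X Y = form Y X := by
  simp only [form, real_inner_comm]; ring

theorem form_add_left (X X' Y : PolyCoord n) : form (X + X') Y = form X Y + form X' Y := by
  simp only [form, Prod.fst_add, Prod.snd_add, inner_add_left]; ring

theorem form_smul_left (c : ℝ) (X Y : PolyCoord n) : form (c • X) Y = c * form X Y := by
  simp only [form, Prod.smul_fst, Prod.smul_snd, real_inner_smul_left, smul_eq_mul]; ring

theorem form_add_right (X Y Y' : PolyCoord n) : form X (Y + Y') = form X Y + form X Y' := by
  rw [form_comm, form_add_left, form_comm Y, form_comm Y']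

theorem form_smul_right (c : ℝ) (X Y : PolyCoord n) : form X (c • Y) = c * form X Y := by
  rw [form_comm, form_smul_left, form_comm]

/-- The fundamental scalar product as a continuous bilinear map. -/
def formL (n : ℕ) : PolyCoord n →L[ℝ] PolyCoord n →L[ℝ] ℝ :=
  LinearMap.toContinuousLinearMap <| (LinearMap.toContinuousLinearMap.toLinearMap :
    (PolyCoord n →ₗ[ℝ] ℝ) →ₗ[ℝ] _) ∘ₗ
    LinearMap.mk₂ ℝ form form_add_left form_smul_left form_add_right form_smul_right

@[simp] theorem formL_apply (X Y : PolyCoord n) : formL n X Y = form X Y := rfl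

theorem form_zero_left (Y : PolyCoord n) : form 0 Y = 0 := by
  rw [← formL_apply, map_zero, _root_.zero_apply]

theorem form_sum_left {κ : Type*} (s : Finset κ) (f : κ → PolyCoord n) (Y : PolyCoord n) :
    form (∑ i ∈ s, f i) Y = ∑ i ∈ s, form (f i) Y := by
  simp only [← formL_apply, map_sum, _root_.sum_apply]

theorem form_sum_right {κ : Type*} (s : Finset κ) (f : κ → PolyCoord n) (Y : PolyCoord n) :
    form Y (∑ i ∈ s, f i) = ∑ i ∈ s, form Y (f i) := by
  simp only [← formL_apply, map_sum]

theorem eq_zero_of_form_eq_zero {X : PolyCoord n} (h : ∀ Y, form X Y = 0) : X = 0 := by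
  have h1 := h (0, X.2.1, 0)
  have h2 := h (1, 0, 0)
  have h3 := h (0, 0, 1)
  simp only [form, mul_zero, sub_zero, inner_self_eq_zero, inner_zero_right, mul_one,
    zero_sub, neg_eq_zero] at h1 h2 h3
  exact Prod.ext h3 (Prod.ext h1 h2)

end Form

/-! ### Linear algebra of a single conformal frame -/

section Basis

variable {n : ℕ}

/-- The scalar products of the elements of a conformal frame at a point. -/
structure IsConformalBasis (b : Module.Basis (FrameIndex n) ℝ (PolyCoord n)) : Prop where
  zero_zero : form (b .zero) (b .zero) = 0
  last_last : form (b .last) (b .last) = 0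
  last_tan : ∀ i, form (b .last) (b (.tan i)) = 0
  last_normal : form (b .last) (b .normal) = 0
  zero_tan : ∀ i, form (b .zero) (b (.tan i)) = 0
  zero_normal : form (b .zero) (b .normal) = 0
  tan_normal : ∀ i, form (b (.tan i)) (b .normal) = 0
  normal_normal : form (b .normal) (b .normal) = 1
  zero_last : form (b .zero) (b .last) = -1

theorem basis_expansion (b : Module.Basis (FrameIndex n) ℝ (PolyCoord n)) (V : PolyCoord n) :
    V = b.coord .zero V • b .zero + ∑ i, b.coord (.tan i) V • b (.tan i)
      + b.coord .normal V • b .normal + b.coord .last V • b .last := by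
  classical
  have key : (LinearMap.id : PolyCoord n →ₗ[ℝ] PolyCoord n)
      = (b.coord .zero).smulRight (b .zero) + ∑ i, (b.coord (.tan i)).smulRight (b (.tan i))
      + (b.coord .normal).smulRight (b .normal) + (b.coord .last).smulRight (b .last) := by
    refine b.ext fun ξ => ?_
    cases ξ <;> simp [Finsupp.single_apply, LinearMap.sum_apply]
  simpa [LinearMap.sum_apply] using LinearMap.congr_fun key V

namespace IsConformalBasis

variable {b : Module.Basis (FrameIndex n) ℝ (PolyCoord n)}

theorem tan_zero (hb : IsConformalBasis b) (i) : form (b (.tan i)) (b .zero) = 0 :=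
  form_comm (b (.tan i)) (b .zero) ▸ hb.zero_tan i

theorem normal_zero (hb : IsConformalBasis b) : form (b .normal) (b .zero) = 0 :=
  form_comm (b .normal) (b .zero) ▸ hb.zero_normal

theorem last_zero (hb : IsConformalBasis b) : form (b .last) (b .zero) = -1 :=
  form_comm (b .last) (b .zero) ▸ hb.zero_last

theorem normal_tan (hb : IsConformalBasis b) (i) : form (b .normal) (b (.tan i)) = 0 :=
  form_comm (b .normal) (b (.tan i)) ▸ hb.tan_normal i

theorem tan_last (hb : IsConformalBasis b) (i) : form (b (.tan i)) (b .last) = 0 :=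
  form_comm (b (.tan i)) (b .last) ▸ hb.last_tan i

theorem normal_last (hb : IsConformalBasis b) : form (b .normal) (b .last) = 0 :=
  form_comm (b .normal) (b .last) ▸ hb.last_normal

theorem form_normal (hb : IsConformalBasis b) (V : PolyCoord n) :
    form V (b .normal) = b.coord .normal V := by
  conv_lhs => rw [basis_expansion b V]
  simp [form_add_left, form_smul_left, form_sum_left, hb.zero_normal, hb.tan_normal,
    hb.normal_normal, hb.last_normal]

/-- A_0 and A_{n+1} are isotropic with product -1, so pairing with one reads off minus the
coordinate along the other. -/
theorem form_last (hb : IsConformalBasis b) (V : PolyCoord n) :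
    form V (b .last) = -b.coord .zero V := by
  conv_lhs => rw [basis_expansion b V]
  simp [form_add_left, form_smul_left, form_sum_left, hb.zero_last, hb.tan_last,
    hb.last_last, hb.normal_last]

theorem form_zero (hb : IsConformalBasis b) (V : PolyCoord n) :
    form V (b .zero) = -b.coord .last V := by
  conv_lhs => rw [basis_expansion b V]
  simp [form_add_left, form_smul_left, form_sum_left, hb.last_zero, hb.tan_zero,
    hb.zero_zero, hb.normal_zero]

theorem form_tan (hb : IsConformalBasis b) (V : PolyCoord n) (j : Fin (n - 1)) :
    form V (b (.tan j)) = ∑ i, b.coord (.tan i) V * form (b (.tan i)) (b (.tan j)) := by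
  conv_lhs => rw [basis_expansion b V]
  simp [form_add_left, form_smul_left, form_sum_left, hb.zero_tan, hb.normal_tan, hb.last_tan]

theorem eq_zero (_hb : IsConformalBasis b) {V : PolyCoord n} (h0 : form V (b .zero) = 0)
    (ht : ∀ i, form V (b (.tan i)) = 0) (hn : form V (b .normal) = 0)
    (hl : form V (b .last) = 0) : V = 0 := by
  refine eq_zero_of_form_eq_zero fun Y => ?_
  rw [basis_expansion b Y]
  simp [form_add_right, form_smul_right, form_sum_right, h0, ht, hn, hl]

/-- A null vector of the Gram matrix would give a combination of the A_i orthogonal to the whole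
frame, hence zero by nondegeneracy of the scalar product, against linear independence. -/
theorem det_gram_ne_zero (hb : IsConformalBasis b) :
    (Matrix.of fun i j => form (b (.tan i)) (b (.tan j))).det ≠ 0 := by
  classical
  intro hdet
  obtain ⟨c, hc, h⟩ := Matrix.exists_vecMul_eq_zero_iff.2 hdet
  have hV : ∑ i, c i • b (.tan i) = 0 := by
    refine hb.eq_zero ?_ (fun j => ?_) ?_ ?_
    · simp [form_sum_left, form_smul_left, hb.tan_zero]
    · simpa [form_sum_left, form_smul_left, Matrix.vecMul, dotProduct] using congrFun h j
    · simp [form_sum_left, form_smul_left, hb.tan_normal]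
    · simp [form_sum_left, form_smul_left, hb.tan_last]
  refine hc (funext fun j => ?_)
  have := congrArg (b.coord (.tan j)) hV
  simpa [Finsupp.single_apply] using this

/-- The vectors orthogonal to `A₀` and to its displacements. -/
theorem eq_of_orthogonal (hb : IsConformalBasis b) {V : PolyCoord n}
    (h0 : form V (b .zero) = 0) (ht : ∀ i, form V (b (.tan i)) = 0) :
    V = form V (b .normal) • b .normal + (-form V (b .last)) • b .zero := by
  have hs : V + (-1 : ℝ) • (form V (b .normal) • b .normal + (-form V (b .last)) • b .zero) = 0 := by
    refine hb.eq_zero ?_ (fun i => ?_) ?_ ?_ <;>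
    simp only [form_add_left, form_smul_left, h0, ht, hb.zero_zero, hb.zero_tan, hb.zero_normal,
      hb.zero_last, hb.normal_zero, hb.normal_tan, hb.normal_normal, hb.normal_last] <;> ring
  rw [neg_one_smul, ← sub_eq_add_neg, sub_eq_zero] at hs
  exact hs

end IsConformalBasis

end Basis

/-! ### Product rules and differentials in charts -/

section Calculus

variable {n : ℕ} {M : Type*} [TopologicalSpace M]
  [ChartedSpace (EuclideanSpace ℝ (Fin (n - 1))) M]
  {F G H : Type*} [NormedAddCommGroup F] [NormedSpace ℝ F] [NormedAddCommGroup G] [NormedSpace ℝ G]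
  [NormedAddCommGroup H] [NormedSpace ℝ H]

/-- One Leibniz rule for continuous bilinear maps serves the scalar product, the multiplication of
vectors by functions and the product of functions alike. -/
theorem hasMFDerivAt_bilin (B : F →L[ℝ] G →L[ℝ] H) {f : M → F} {h : M → G} {x : M}
    {f' : EuclideanSpace ℝ (Fin (n - 1)) →L[ℝ] F} {h' : EuclideanSpace ℝ (Fin (n - 1)) →L[ℝ] G}
    (hf : HasMFDerivAt (𝓡 (n - 1)) 𝓘(ℝ, F) f x f')
    (hh : HasMFDerivAt (𝓡 (n - 1)) 𝓘(ℝ, G) h x h') :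
    HasMFDerivAt (𝓡 (n - 1)) 𝓘(ℝ, H) (fun y => B (f y) (h y)) x
      (B.precompR (EuclideanSpace ℝ (Fin (n - 1))) (f x) h'
        + B.precompL (EuclideanSpace ℝ (Fin (n - 1))) f' (h x)) := by
  refine ⟨(B.continuous.continuousAt.comp hf.1).clm_apply hh.1, ?_⟩
  have h1 : HasFDerivWithinAt (f ∘ (extChartAt (𝓡 (n - 1)) x).symm) f'
    (Set.range (𝓡 (n - 1))) (extChartAt (𝓡 (n - 1)) x x) := hf.2
  have h2 : HasFDerivWithinAt (h ∘ (extChartAt (𝓡 (n - 1)) x).symm) h'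
    (Set.range (𝓡 (n - 1))) (extChartAt (𝓡 (n - 1)) x x) := hh.2
  have h3 := B.hasFDerivWithinAt_of_bilinear h1 h2
  simp only [Function.comp_apply, extChartAt_to_inv] at h3
  exact h3

theorem mfderiv_bilin (B : F →L[ℝ] G →L[ℝ] H) {f : M → F} {h : M → G} {x : M}
    (hf : MDifferentiableAt (𝓡 (n - 1)) 𝓘(ℝ, F) f x)
    (hh : MDifferentiableAt (𝓡 (n - 1)) 𝓘(ℝ, G) h x) (v : TangentSpace (𝓡 (n - 1)) x) :
    mfderiv (𝓡 (n - 1)) 𝓘(ℝ, H) (fun y => B (f y) (h y)) x v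
      = B (f x) (mfderiv (𝓡 (n - 1)) 𝓘(ℝ, G) h x v)
        + B (mfderiv (𝓡 (n - 1)) 𝓘(ℝ, F) f x v) (h x) :=
  DFunLike.congr_fun (hasMFDerivAt_bilin B hf.hasMFDerivAt hh.hasMFDerivAt).mfderiv v

theorem diffReal_form {f h : M → PolyCoord n} {x : M}
    (hf : MDifferentiableAt (𝓡 (n - 1)) 𝓘(ℝ, PolyCoord n) f x)
    (hh : MDifferentiableAt (𝓡 (n - 1)) 𝓘(ℝ, PolyCoord n) h x) (v : TangentSpace (𝓡 (n - 1)) x) :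
    diffReal (fun y => form (f y) (h y)) x v = form (f x) (diff h x v) + form (diff f x v) (h x) :=
  mfderiv_bilin (formL n) hf hh v

theorem diff_smul {c : M → ℝ} {f : M → PolyCoord n} {x : M}
    (hc : MDifferentiableAt (𝓡 (n - 1)) 𝓘(ℝ, ℝ) c x)
    (hf : MDifferentiableAt (𝓡 (n - 1)) 𝓘(ℝ, PolyCoord n) f x) (v : TangentSpace (𝓡 (n - 1)) x) :
    diff (fun y => c y • f y) x v = c x • diff f x v + diffReal c x v • f x :=
  mfderiv_bilin (ContinuousLinearMap.lsmul ℝ ℝ) hc hf v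

theorem diffReal_mul {c f : M → ℝ} {x : M}
    (hc : MDifferentiableAt (𝓡 (n - 1)) 𝓘(ℝ, ℝ) c x)
    (hf : MDifferentiableAt (𝓡 (n - 1)) 𝓘(ℝ, ℝ) f x) (v : TangentSpace (𝓡 (n - 1)) x) :
    diffReal (fun y => c y * f y) x v = c x * diffReal f x v + diffReal c x v * f x :=
  mfderiv_bilin (ContinuousLinearMap.mul ℝ ℝ) hc hf v

theorem diff_add {f h : M → PolyCoord n} {x : M}
    (hf : MDifferentiableAt (𝓡 (n - 1)) 𝓘(ℝ, PolyCoord n) f x)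
    (hh : MDifferentiableAt (𝓡 (n - 1)) 𝓘(ℝ, PolyCoord n) h x) (v : TangentSpace (𝓡 (n - 1)) x) :
    diff (fun y => f y + h y) x v = diff f x v + diff h x v := by
  have := (hf.hasMFDerivAt.add hh.hasMFDerivAt).mfderiv
  exact DFunLike.congr_fun this v

theorem contDiffAt_bilin {E : Type*} [NormedAddCommGroup E] [NormedSpace ℝ E]
    (B : F →L[ℝ] G →L[ℝ] H) {f : E → F} {h : E → G} {z : E} {k : ℕ∞ω}
    (hf : ContDiffAt ℝ k f z) (hh : ContDiffAt ℝ k h z) :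
    ContDiffAt ℝ k (fun y => B (f y) (h y)) z :=
  B.isBoundedBilinearMap.contDiff.contDiffAt.comp (f := fun y => (f y, h y)) z (hf.prodMk hh)

theorem contMDiffAt_bilin (B : F →L[ℝ] G →L[ℝ] H) {f : M → F} {h : M → G} {x : M} {k : ℕ∞ω}
    (hf : ContMDiffAt (𝓡 (n - 1)) 𝓘(ℝ, F) k f x) (hh : ContMDiffAt (𝓡 (n - 1)) 𝓘(ℝ, G) k h x) :
    ContMDiffAt (𝓡 (n - 1)) 𝓘(ℝ, H) k (fun y => B (f y) (h y)) x :=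
  ContDiffAt.comp_contMDiffAt (g := fun p : F × G => B p.1 p.2)
    (B.isBoundedBilinearMap.contDiff.contDiffAt) (hf.prodMk_space hh)

theorem isOpen_chart_preimage {O : Set M} (hO : IsOpen O) (p : M) :
    IsOpen ((extChartAt (𝓡 (n - 1)) p).target ∩ (extChartAt (𝓡 (n - 1)) p).symm ⁻¹' O) :=
  (continuousOn_extChartAt_symm p).isOpen_inter_preimage (isOpen_extChartAt_target p) hO

variable [IsManifold (𝓡 (n - 1)) ∞ M]

theorem mdifferentiableAt_comp_extChartAt_symm {f : M → F} {p y : M}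
    (hy : y ∈ (extChartAt (𝓡 (n - 1)) p).source)
    (hf : MDifferentiableAt (𝓡 (n - 1)) 𝓘(ℝ, F) f y) :
    DifferentiableAt ℝ (f ∘ (extChartAt (𝓡 (n - 1)) p).symm) (extChartAt (𝓡 (n - 1)) p y) := by
  rw [← mdifferentiableAt_iff_differentiableAt]
  have hs : MDifferentiableAt 𝓘(ℝ, EuclideanSpace ℝ (Fin (n - 1))) (𝓡 (n - 1))
      (extChartAt (𝓡 (n - 1)) p).symm (extChartAt (𝓡 (n - 1)) p y) :=
    ((contMDiffOn_extChartAt_symm (n := ∞) p).contMDiffAt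
      ((isOpen_extChartAt_target p).mem_nhds
        ((extChartAt (𝓡 (n - 1)) p).map_source hy))).mdifferentiableAt (by simp)
  refine MDifferentiableAt.comp _ ?_ hs
  rwa [(extChartAt (𝓡 (n - 1)) p).left_inv hy]

/-- A differential, computed in a chart. -/
theorem mfderiv_eq_fderiv_chart {f : M → F} {p y : M}
    (hy : y ∈ (extChartAt (𝓡 (n - 1)) p).source)
    (hf : MDifferentiableAt (𝓡 (n - 1)) 𝓘(ℝ, F) f y) (v : TangentSpace (𝓡 (n - 1)) y) :
    mfderiv (𝓡 (n - 1)) 𝓘(ℝ, F) f y v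
      = fderiv ℝ (f ∘ (extChartAt (𝓡 (n - 1)) p).symm) (extChartAt (𝓡 (n - 1)) p y)
        (mfderiv (𝓡 (n - 1)) 𝓘(ℝ, EuclideanSpace ℝ (Fin (n - 1)))
          (extChartAt (𝓡 (n - 1)) p) y v) := by
  have he : f =ᶠ[nhds y]
      (f ∘ (extChartAt (𝓡 (n - 1)) p).symm) ∘ extChartAt (𝓡 (n - 1)) p := by
    filter_upwards [extChartAt_source_mem_nhds' (I := 𝓡 (n - 1)) hy] with z hz
    simp only [Function.comp_apply, (extChartAt (𝓡 (n - 1)) p).left_inv hz]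
  have hd := mdifferentiableAt_comp_extChartAt_symm hy hf
  rw [he.mfderiv_eq, ← mfderiv_eq_fderiv]
  refine mfderiv_comp_apply y hd.mdifferentiableAt ?_ v
  exact (contMDiffAt_extChartAt' (n := ∞)
    (by rwa [extChartAt_source] at hy)).mdifferentiableAt (by simp)

/-- The differential at `y` of the chart at `p`. -/
def chartDiff (p y : M) : TangentSpace (𝓡 (n - 1)) y →L[ℝ] EuclideanSpace ℝ (Fin (n - 1)) :=
  mfderiv (𝓡 (n - 1)) 𝓘(ℝ, EuclideanSpace ℝ (Fin (n - 1))) (extChartAt (𝓡 (n - 1)) p) y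

theorem chartDiff_bijective {p y : M} (hy : y ∈ (extChartAt (𝓡 (n - 1)) p).source) :
    Function.Bijective (chartDiff (n := n) p y) := by
  have : IsManifold (𝓡 (n - 1)) 1 M := IsManifold.of_le (n := ∞) (by simp)
  obtain ⟨e, he⟩ := isInvertible_mfderiv_extChartAt (I := 𝓡 (n - 1)) hy
  unfold chartDiff
  rw [← he]
  exact e.bijective

theorem diff_eq_fderiv_chart {f : M → PolyCoord n} {p y : M}
    (hy : y ∈ (extChartAt (𝓡 (n - 1)) p).source)
    (hf : MDifferentiableAt (𝓡 (n - 1)) 𝓘(ℝ, PolyCoord n) f y) (v : TangentSpace (𝓡 (n - 1)) y) :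
    diff f y v = fderiv ℝ (f ∘ (extChartAt (𝓡 (n - 1)) p).symm) (extChartAt (𝓡 (n - 1)) p y)
      (chartDiff (n := n) p y v) :=
  mfderiv_eq_fderiv_chart hy hf v

/-- The coordinate expression of a smooth map is smooth. -/
theorem contDiffOn_comp_extChartAt_symm {f : M → F} {O : Set M} (p : M)
    (hf : ContMDiffOn (𝓡 (n - 1)) 𝓘(ℝ, F) ∞ f O) :
    ContDiffOn ℝ ∞ (f ∘ (extChartAt (𝓡 (n - 1)) p).symm)
      ((extChartAt (𝓡 (n - 1)) p).target ∩ (extChartAt (𝓡 (n - 1)) p).symm ⁻¹' O) := by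
  rw [← contMDiffOn_iff_contDiffOn]
  exact hf.comp ((contMDiffOn_extChartAt_symm p).mono Set.inter_subset_left)
    Set.inter_subset_right

end Calculus

/-! ### Infinitesimal displacements of a frame field -/

theorem g_comm {n : ℕ} {M : Type*} {A : M → Module.Basis (FrameIndex n) ℝ (PolyCoord n)} {x : M}
    (i j : Fin (n - 1)) : g A x i j = g A x j i := form_comm _ _

section Frame

variable {n : ℕ} {M : Type*} [TopologicalSpace M]
  [ChartedSpace (EuclideanSpace ℝ (Fin (n - 1))) M]
  {X : M → ConformalSpace n} {A : M → Module.Basis (FrameIndex n) ℝ (PolyCoord n)} {O : Set M}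
  {x : M}

/-- Applied to the constant scalar products of a frame, this yields the linear relations among the
forms ω. -/
theorem form_diff_add_form_diff_of_const {f h : M → PolyCoord n} {c : ℝ} (hO : O ∈ nhds x)
    (hf : MDifferentiableAt (𝓡 (n - 1)) 𝓘(ℝ, PolyCoord n) f x)
    (hh : MDifferentiableAt (𝓡 (n - 1)) 𝓘(ℝ, PolyCoord n) h x)
    (hc : ∀ y ∈ O, form (f y) (h y) = c) (v : TangentSpace (𝓡 (n - 1)) x) :
    form (f x) (diff h x v) + form (diff f x v) (h x) = 0 := by
  rw [← diffReal_form hf hh]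
  have he : (fun y => form (f y) (h y)) =ᶠ[nhds x] fun _ => c := by
    filter_upwards [hO] with y hy using hc y hy
  have : mfderiv (𝓡 (n - 1)) 𝓘(ℝ, ℝ) (fun y => form (f y) (h y)) x = 0 := by
    rw [he.mfderiv_eq, mfderiv_const]
    rfl
  exact DFunLike.congr_fun this v

theorem om_apply (ξ η : FrameIndex n) (v : TangentSpace (𝓡 (n - 1)) x) :
    om A ξ η x v = (A x).coord η (diff (fun y => A y ξ) x v) := rfl

theorem coframe_apply (v : TangentSpace (𝓡 (n - 1)) x) (i : Fin (n - 1)) :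
    coframe A x v i = (A x).coord (.tan i) (diff (fun y => A y .zero) x v) := rfl

namespace IsFrameField

theorem isConformalBasis (h : IsFrameField X A O) (hx : x ∈ O) : IsConformalBasis (A x) where
  zero_zero := h.zero_zero x hx
  last_last := h.last_last x hx
  last_tan := h.last_tan x hx
  last_normal := h.last_normal x hx
  zero_tan := h.zero_tan x hx
  zero_normal := h.zero_normal x hx
  tan_normal := h.tan_normal x hx
  normal_normal := h.normal_normal x hx
  zero_last := h.zero_last x hx

theorem mem_nhds (h : IsFrameField X A O) (hx : x ∈ O) : O ∈ nhds x := h.isOpen.mem_nhds hx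

theorem contMDiffAt (h : IsFrameField X A O) (hx : x ∈ O) (ξ : FrameIndex n) :
    ContMDiffAt (𝓡 (n - 1)) 𝓘(ℝ, PolyCoord n) ∞ (fun y => A y ξ) x :=
  (h.smooth ξ).contMDiffAt (h.mem_nhds hx)

theorem mdifferentiableAt (h : IsFrameField X A O) (hx : x ∈ O) (ξ : FrameIndex n) :
    MDifferentiableAt (𝓡 (n - 1)) 𝓘(ℝ, PolyCoord n) (fun y => A y ξ) x :=
  (h.contMDiffAt hx ξ).mdifferentiableAt (by simp)

theorem isSmoothLift (h : IsFrameField X A O) : IsSmoothLift X (fun y => A y .zero) O where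
  isOpen := h.isOpen
  smooth := h.smooth .zero
  lift y hy := ⟨(A y).ne_zero .zero, h.point y hy⟩

theorem form_diff_zero_zero (h : IsFrameField X A O) (hx : x ∈ O)
    (v : TangentSpace (𝓡 (n - 1)) x) :
    form (diff (fun y => A y .zero) x v) (A x .zero) = 0 := by
  have := form_diff_add_form_diff_of_const (h.mem_nhds hx) (h.mdifferentiableAt hx .zero)
    (h.mdifferentiableAt hx .zero) h.zero_zero v
  rw [form_comm] at this
  linarith

theorem form_diff_normal_normal (h : IsFrameField X A O) (hx : x ∈ O)
    (v : TangentSpace (𝓡 (n - 1)) x) :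
    form (diff (fun y => A y .normal) x v) (A x .normal) = 0 := by
  have := form_diff_add_form_diff_of_const (h.mem_nhds hx) (h.mdifferentiableAt hx .normal)
    (h.mdifferentiableAt hx .normal) h.normal_normal v
  rw [form_comm] at this
  linarith

theorem form_diff_normal_zero (h : IsFrameField X A O) (hx : x ∈ O)
    (v : TangentSpace (𝓡 (n - 1)) x) :
    form (diff (fun y => A y .normal) x v) (A x .zero) = 0 := by
  have := form_diff_add_form_diff_of_const (h.mem_nhds hx) (h.mdifferentiableAt hx .zero)
    (h.mdifferentiableAt hx .normal) h.zero_normal v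
  rw [form_comm, h.tangent x hx v] at this
  linarith

/-- ω_0^n vanishes because A_n is tangent, and ω_0^{n+1} because A_0 stays isotropic. -/
theorem diff_zero_eq (h : IsFrameField X A O) (hx : x ∈ O) (v : TangentSpace (𝓡 (n - 1)) x) :
    diff (fun y => A y .zero) x v
      = om A .zero .zero x v • A x .zero + ∑ i, coframe A x v i • A x (.tan i) := by
  have hb := h.isConformalBasis hx
  have h1 : (A x).coord .normal (diff (fun y => A y .zero) x v) = 0 := by
    rw [← hb.form_normal, h.tangent x hx v]
  have h2 : (A x).coord .last (diff (fun y => A y .zero) x v) = 0 := by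
    rw [← neg_eq_zero, ← hb.form_zero, h.form_diff_zero_zero hx v]
  conv_lhs => rw [basis_expansion (A x) (diff (fun y => A y .zero) x v), h1, h2, zero_smul,
    zero_smul, add_zero, add_zero]
  rfl

theorem form_diff_zero_tan (h : IsFrameField X A O) (hx : x ∈ O) (v : TangentSpace (𝓡 (n - 1)) x)
    (j : Fin (n - 1)) :
    form (diff (fun y => A y .zero) x v) (A x (.tan j)) = (g A x *ᵥ coframe A x v) j := by
  rw [(h.isConformalBasis hx).form_tan]
  change _ = ∑ i, g A x j i * coframe A x v i
  refine Finset.sum_congr rfl fun i _ => ?_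
  rw [g_comm, mul_comm]
  rfl

theorem det_g_ne_zero (h : IsFrameField X A O) (hx : x ∈ O) : (g A x).det ≠ 0 :=
  (h.isConformalBasis hx).det_gram_ne_zero

/-- Homogeneous coordinates of the points of the hypersurface are proportional to `A₀`. -/
theorem exists_eq_smul_of_isSmoothLift (h : IsFrameField X A O) (hx : x ∈ O)
    {Y : M → PolyCoord n} {O' : Set M} (hY : IsSmoothLift X Y O') (hx' : x ∈ O') :
    ∃ (k : ℝ) (m : TangentSpace (𝓡 (n - 1)) x →L[ℝ] ℝ), k ≠ 0 ∧ Y x = k • A x .zero ∧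
      ∀ v, diff Y x v = k • diff (fun y => A y .zero) x v + m v • A x .zero := by
  -- As (A_0, A_{n+1}) = -1, the proportionality factor is -(Y, A_{n+1}); this formula shows that it
  -- is smooth.
  have hk : ∀ y ∈ O ∩ O', Y y = (-form (Y y) (A y .last)) • A y .zero := by
    rintro y ⟨hy, hy'⟩
    obtain ⟨h0, hmk⟩ := hY.lift y hy'
    rw [← h.point y hy, Projectivization.mk_eq_mk_iff'] at hmk
    obtain ⟨a, ha⟩ := hmk
    rw [← ha, form_smul_left, h.zero_last y hy]
    simp
  have hO : O ∩ O' ∈ nhds x := Filter.inter_mem (h.mem_nhds hx) (hY.isOpen.mem_nhds hx')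
  have hd : MDifferentiableAt (𝓡 (n - 1)) 𝓘(ℝ, ℝ) (fun y => -form (Y y) (A y .last)) x :=
    ((contMDiffAt_bilin (-formL n) (hY.smooth.contMDiffAt (hY.isOpen.mem_nhds hx'))
      (h.contMDiffAt hx .last))).mdifferentiableAt (by simp)
  refine ⟨-form (Y x) (A x .last), diffReal (fun y => -form (Y y) (A y .last)) x, ?_,
    hk x ⟨hx, hx'⟩, fun v => ?_⟩
  · intro h0
    obtain ⟨hne, -⟩ := hY.lift x hx'
    exact hne (by rw [hk x ⟨hx, hx'⟩, h0, zero_smul])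
  · rw [← diff_smul hd (h.mdifferentiableAt hx .zero)]
    have he : Y =ᶠ[nhds x] fun y => (-form (Y y) (A y .last)) • A y .zero := by
      filter_upwards [hO] with y hy using hk y hy
    exact DFunLike.congr_fun he.mfderiv_eq v

/-- If all ω^i(v) vanish, then dA_0(v) is a multiple of A_0, so dY(v) is a multiple of Y for any
lift Y, and the immersion condition gives v = 0. Surjectivity follows by dimension. -/
theorem coframe_bijective (h : IsFrameField X A O) (hX : IsHypersurface X) (hx : x ∈ O) :
    Function.Bijective (coframe A x) := by
  have hinj : Function.Injective (coframe A x) := by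
    refine (injective_iff_map_eq_zero _).2 fun v hv => ?_
    obtain ⟨O', Y, hx', hY, hYinj⟩ := hX x
    obtain ⟨k, m, hk, hYx, hd⟩ := h.exists_eq_smul_of_isSmoothLift hx hY hx'
    refine hYinj v ?_
    rw [hd, h.diff_zero_eq hx, hv, hYx]
    refine Submodule.mem_span_singleton.2 ⟨om A .zero .zero x v + k⁻¹ * m v, ?_⟩
    simp only [Pi.zero_apply, zero_smul, Finset.sum_const_zero, add_zero, smul_smul, ← add_smul]
    congr 1
    field_simp
  refine ⟨hinj, ?_⟩
  have hd : Module.finrank ℝ (EuclideanSpace ℝ (Fin (n - 1)))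
    = Module.finrank ℝ (Fin (n - 1) → ℝ) := by simp
  let c : EuclideanSpace ℝ (Fin (n - 1)) →ₗ[ℝ] Fin (n - 1) → ℝ := (coframe A x).toLinearMap
  exact (LinearMap.injective_iff_surjective_of_finrank_eq_finrank (f := c) hd).1 hinj

/-- `dualVec` is built from `ContinuousLinearMap.inverse`, which is zero by default on
non-invertible maps; bijectivity of the coframe makes it the true inverse. -/
theorem coframe_dualVec (h : IsFrameField X A O) (hX : IsHypersurface X) (hx : x ∈ O)
    (j : Fin (n - 1)) : coframe A x (dualVec A j x) = Pi.single j 1 := by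
  let c : EuclideanSpace ℝ (Fin (n - 1)) →L[ℝ] Fin (n - 1) → ℝ := coframe A x
  let e := ContinuousLinearEquiv.ofBijective c
    (LinearMap.ker_eq_bot.2 (h.coframe_bijective hX hx).1)
    (LinearMap.range_eq_top.2 (h.coframe_bijective hX hx).2)
  have he : c = e := by ext; rfl
  have h1 : dualVec A j x = e.symm (Pi.single j 1) := by
    unfold dualVec
    exact DFunLike.congr_fun ((congrArg _ he).trans (ContinuousLinearMap.inverse_equiv e)) _
  rw [h1]
  exact e.apply_symm_apply _

theorem om_tan_normal (h : IsFrameField X A O) (hX : IsHypersurface X) (hx : x ∈ O)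
    (i : Fin (n - 1)) (v : TangentSpace (𝓡 (n - 1)) x) :
    om A (.tan i) .normal x v = (lam A x *ᵥ coframe A x v) i := by
  have hv : v = ∑ j, coframe A x v j • dualVec A j x := by
    refine (h.coframe_bijective hX hx).1 ?_
    rw [map_sum]
    simp only [map_smul, h.coframe_dualVec hX hx]
    ext k
    simp [Pi.single_apply]
  conv_lhs => rw [hv, map_sum]
  refine Finset.sum_congr rfl fun j _ => ?_
  rw [map_smul, smul_eq_mul, mul_comm]
  rfl

/-- The Weingarten relation, obtained by differentiating (A_i, A_n) = 0. -/
theorem form_diff_normal_tan (h : IsFrameField X A O) (hX : IsHypersurface X) (hx : x ∈ O)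
    (v : TangentSpace (𝓡 (n - 1)) x) (i : Fin (n - 1)) :
    form (diff (fun y => A y .normal) x v) (A x (.tan i)) = -(lam A x *ᵥ coframe A x v) i := by
  have := form_diff_add_form_diff_of_const (h.mem_nhds hx) (h.mdifferentiableAt hx (.tan i))
    (h.mdifferentiableAt hx .normal) (fun y hy => h.tan_normal y hy i) v
  rw [(h.isConformalBasis hx).form_normal, ← om_apply, h.om_tan_normal hX hx, form_comm] at this
  linarith

end IsFrameField

section Symmetry

variable [IsManifold (𝓡 (n - 1)) ∞ M]

/-- If `h` is everywhere orthogonal to the differential of `f`, the products of the differentials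
of `f` and `h` are symmetric. -/
theorem form_diff_diff_comm {f h : M → PolyCoord n} (hO : IsOpen O) (hx : x ∈ O)
    (hf : ContMDiffOn (𝓡 (n - 1)) 𝓘(ℝ, PolyCoord n) ∞ f O)
    (hh : ContMDiffOn (𝓡 (n - 1)) 𝓘(ℝ, PolyCoord n) ∞ h O)
    (hfh : ∀ y ∈ O, ∀ v : TangentSpace (𝓡 (n - 1)) y, form (diff f y v) (h y) = 0)
    (u v : TangentSpace (𝓡 (n - 1)) x) :
    form (diff f x u) (diff h x v) = form (diff f x v) (diff h x u) := by
  set φ := extChartAt (𝓡 (n - 1)) x with hφ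
  set W := φ.target ∩ φ.symm ⁻¹' O with hWdef
  have hW : IsOpen W := isOpen_chart_preimage hO x
  have hmd : ∀ {k : M → PolyCoord n}, ContMDiffOn (𝓡 (n - 1)) 𝓘(ℝ, PolyCoord n) ∞ k O →
      ∀ y ∈ O, MDifferentiableAt (𝓡 (n - 1)) 𝓘(ℝ, PolyCoord n) k y := fun hk y hy =>
    (hk.contMDiffAt (hO.mem_nhds hy)).mdifferentiableAt (by simp)
  have hf' := contDiffOn_comp_extChartAt_symm x hf
  have hh' := contDiffOn_comp_extChartAt_symm x hh
  have horth : ∀ z ∈ W, ∀ w, form (fderiv ℝ (f ∘ φ.symm) z w) ((h ∘ φ.symm) z) = 0 := by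
    rintro z ⟨hz, hzO⟩ w
    have hs := φ.map_target hz
    obtain ⟨w', rfl⟩ := (chartDiff_bijective hs).2 w
    have := hfh _ hzO w'
    rwa [diff_eq_fderiv_chart hs (hmd hf _ hzO), ← hφ, φ.right_inv hz] at this
  have hz₀ : φ x ∈ W := ⟨mem_extChartAt_target x, by
    rw [Set.mem_preimage, hφ, extChartAt_to_inv]; exact hx⟩
  have hsymm : IsSymmSndFDerivAt ℝ (f ∘ φ.symm) (φ x) :=
    (hf'.contDiffAt (hW.mem_nhds hz₀)).isSymmSndFDerivAt (by
      rw [minSmoothness_of_isRCLikeNormedField]; exact WithTop.coe_le_coe.2 (le_top : (2 : ℕ∞) ≤ ⊤))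
  have hd2 : HasFDerivAt (fderiv ℝ (f ∘ φ.symm)) (fderiv ℝ (fderiv ℝ (f ∘ φ.symm)) (φ x)) (φ x) :=
    (((hf'.contDiffAt (hW.mem_nhds hz₀)).fderiv_right (m := 1) (by
      rw [one_add_one_eq_two]; exact WithTop.coe_le_coe.2 (le_top : (2 : ℕ∞) ≤ ⊤))).differentiableAt one_ne_zero).hasFDerivAt
  have hdh : HasFDerivAt (h ∘ φ.symm) (fderiv ℝ (h ∘ φ.symm) (φ x)) (φ x) :=
    ((hh'.contDiffAt (hW.mem_nhds hz₀)).differentiableAt (by simp)).hasFDerivAt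
  -- Differentiating (df(a), h) = 0 in the direction b trades the product of first differentials for
  -- the second derivative of f, which is symmetric.
  have key : ∀ a b, form (fderiv ℝ (f ∘ φ.symm) (φ x) a) (fderiv ℝ (h ∘ φ.symm) (φ x) b)
      = -form (fderiv ℝ (fderiv ℝ (f ∘ φ.symm)) (φ x) b a) ((h ∘ φ.symm) (φ x)) := by
    intro a b
    have h1 := (formL n).hasFDerivAt_of_bilinear (hd2.clm_apply (hasFDerivAt_const a (φ x))) hdh
    have h2 : (fun z => formL n (fderiv ℝ (f ∘ φ.symm) z a) ((h ∘ φ.symm) z))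
        =ᶠ[nhds (φ x)] fun _ => 0 := by
      filter_upwards [hW.mem_nhds hz₀] with z hz using horth z hz a
    have h3 := DFunLike.congr_fun ((h1.congr_of_eventuallyEq h2.symm).unique
      (hasFDerivAt_const (0 : ℝ) (φ x))) b
    simp at h3
    rw [Function.comp_apply]
    linarith
  have hch : ∀ {k : M → PolyCoord n}, ContMDiffOn (𝓡 (n - 1)) 𝓘(ℝ, PolyCoord n) ∞ k O →
      ∀ w, diff k x w = fderiv ℝ (k ∘ φ.symm) (φ x) (chartDiff (n := n) x x w) := fun hk w =>
    diff_eq_fderiv_chart (mem_extChartAt_source x) (hmd hk x hx) w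
  rw [hch hf, hch hf, hch hh, hch hh, key, key, hsymm]

/-- (dA_0(e_i), dA_n(e_j)) = -λ_ij, and `form_diff_diff_comm` makes the left side symmetric. This
replaces the structure equations and Cartan's lemma. -/
theorem IsFrameField.lam_comm (h : IsFrameField X A O) (hX : IsHypersurface X) (hx : x ∈ O)
    (i j : Fin (n - 1)) : lam A x i j = lam A x j i := by
  have key : ∀ i j, form (diff (fun y => A y .zero) x (dualVec A i x))
      (diff (fun y => A y .normal) x (dualVec A j x)) = -lam A x i j := by
    intro i j
    rw [h.diff_zero_eq hx, form_comm, form_add_right, form_smul_right,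
      h.form_diff_normal_zero hx, form_sum_right, h.coframe_dualVec hX hx]
    simp only [form_smul_right, h.form_diff_normal_tan hX hx, h.coframe_dualVec hX hx]
    simp [Pi.single_apply]
  have := form_diff_diff_comm h.isOpen hx (h.smooth .zero) (h.smooth .normal) h.tangent
    (dualVec A i x) (dualVec A j x)
  rw [key, key] at this
  linarith

end Symmetry

end Frame

/-! ### Constant rank theorem for one-dimensional kernels -/

section ConstantRank

open Module

variable {E E' F : Type*} [NormedAddCommGroup E] [NormedSpace ℝ E] [FiniteDimensional ℝ E]
  [NormedAddCommGroup E'] [NormedSpace ℝ E'] [FiniteDimensional ℝ E']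
  [NormedAddCommGroup F] [NormedSpace ℝ F] [FiniteDimensional ℝ F]

/-- For a linear map with one-dimensional kernel, coordinates on its range together with a
functional give an isomorphism. -/
theorem exists_projection_and_functional (D : E →L[ℝ] F) (hD : finrank ℝ D.ker = 1)
    (hdim : finrank ℝ E = finrank ℝ E' + 1) :
    ∃ (P : F →L[ℝ] E') (Q : E →L[ℝ] ℝ) (e : E ≃L[ℝ] E' × ℝ),
      (e : E →L[ℝ] E' × ℝ) = (P ∘L D).prod Q := by
  have hr : finrank ℝ D.range = finrank ℝ E' := by
    have := D.toLinearMap.finrank_range_add_finrank_ker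
    change finrank ℝ D.range + finrank ℝ D.ker = _ at this
    omega
  -- q retracts F onto the range of D, and r below retracts E onto the kernel. Identified with E'
  -- and ℝ, they detect D v and the kernel part of v.
  obtain ⟨q, hq⟩ := D.range.subtype.exists_leftInverse_of_injective (Submodule.ker_subtype _)
  let P₀ : F →ₗ[ℝ] E' := (LinearEquiv.ofFinrankEq _ _ hr).toLinearMap ∘ₗ q
  have hP₀ : ∀ v, P₀ (D v) = 0 → D v = 0 := by
    intro v hv
    have h1 : q (D v) = 0 := (LinearEquiv.ofFinrankEq _ _ hr).map_eq_zero_iff.1 hv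
    have h2 : q (D v) = ⟨D v, ⟨v, rfl⟩⟩ := LinearMap.congr_fun hq ⟨D v, ⟨v, rfl⟩⟩
    rw [h2] at h1
    exact congrArg Subtype.val h1
  obtain ⟨r, hr'⟩ := D.ker.subtype.exists_leftInverse_of_injective (Submodule.ker_subtype _)
  have hk : finrank ℝ D.ker = finrank ℝ ℝ := by simpa using hD
  let Q₀ : E →ₗ[ℝ] ℝ := (LinearEquiv.ofFinrankEq _ _ hk).toLinearMap ∘ₗ r
  have hQ₀ : ∀ v ∈ D.ker, Q₀ v = 0 → v = 0 := by
    intro v hv h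
    have h1 : r v = 0 := (LinearEquiv.ofFinrankEq _ _ hk).map_eq_zero_iff.1 h
    have h2 : r v = ⟨v, hv⟩ := LinearMap.congr_fun hr' ⟨v, hv⟩
    rw [h2] at h1
    exact congrArg Subtype.val h1
  let P : F →L[ℝ] E' := LinearMap.toContinuousLinearMap P₀
  let Q : E →L[ℝ] ℝ := LinearMap.toContinuousLinearMap Q₀
  have hinj : Function.Injective ((P ∘L D).prod Q) := by
    refine (injective_iff_map_eq_zero _).2 fun v hv => ?_
    have h1 : P₀ (D v) = 0 := congrArg Prod.fst hv
    have h2 : Q₀ v = 0 := congrArg Prod.snd hv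
    exact hQ₀ v (hP₀ v h1) h2
  refine ⟨P, Q, (LinearEquiv.ofInjectiveOfFinrankEq ((P ∘L D).prod Q).toLinearMap hinj
    (by simp [hdim])).toContinuousLinearEquiv, ?_⟩
  ext v <;> rfl

/-- The constant rank theorem for maps with one-dimensional kernels: such a map factors
locally through a submersion with the same kernels. -/
theorem exists_factorization_of_finrank_ker_eq_one {f : E → F} {W : Set E} {z₀ : E}
    (hW : IsOpen W) (hz₀ : z₀ ∈ W) (hf : ContDiffOn ℝ ∞ f W)
    (hker : ∀ z ∈ W, finrank ℝ (fderiv ℝ f z).ker = 1)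
    (hdim : finrank ℝ E = finrank ℝ E' + 1) :
    ∃ (U : Set E) (T : Set E') (B : E' → F) (τ : E → E'), IsOpen U ∧ z₀ ∈ U ∧ U ⊆ W ∧ IsOpen T ∧
      ContDiffOn ℝ ∞ B T ∧ ContDiffOn ℝ ∞ τ U ∧ τ '' U = T ∧ (∀ z ∈ U, B (τ z) = f z) ∧
      (∀ z ∈ U, ∀ v, fderiv ℝ τ z v = 0 ↔ fderiv ℝ f z v = 0) ∧
      ∀ z ∈ U, Function.Surjective (fderiv ℝ τ z) := by
  obtain ⟨P, Q, e₀, he₀⟩ := exists_projection_and_functional (E' := E') _ (hker z₀ hz₀) hdim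
  have hfd : ∀ z ∈ W, HasFDerivAt f (fderiv ℝ f z) z := fun z hz =>
    ((hf.differentiableOn (by simp)).differentiableAt (hW.mem_nhds hz)).hasFDerivAt
  -- Φ straightens f: its first component will be τ, and its second component is a coordinate along
  -- the fibres.
  let Φ : E → E' × ℝ := fun z => (P (f z), Q z)
  have hΦd : ∀ z ∈ W, HasFDerivAt Φ ((P ∘L fderiv ℝ f z).prod Q) z := fun z hz =>
    (P.hasFDerivAt.comp z (hfd z hz)).prodMk Q.hasFDerivAt
  have hΦ : ContDiffOn ℝ ∞ Φ W :=
    (P.contDiff.comp_contDiffOn hf).prodMk Q.contDiff.contDiffOn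
  -- The points where dΦ is still invertible; this set is open because isomorphisms form an open
  -- set.
  let W' : Set E := W ∩ (fun z => (P ∘L fderiv ℝ f z).prod Q) ⁻¹'
    Set.range (ContinuousLinearEquiv.toContinuousLinearMap : (E ≃L[ℝ] E' × ℝ) → _)
  have hcont : ContinuousOn (fun z => (P ∘L fderiv ℝ f z).prod Q) W := by
    have h1 : ContinuousOn (fderiv ℝ f) W := hf.continuousOn_fderiv_of_isOpen hW (by simp)
    have h2 : ContinuousOn (fderiv ℝ Φ) W := hΦ.continuousOn_fderiv_of_isOpen hW (by simp)
    exact h2.congr fun z hz => (hΦd z hz).fderiv.symm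
  have hW' : IsOpen W' := hcont.isOpen_inter_preimage hW ContinuousLinearEquiv.isOpen
  have hz₀' : z₀ ∈ W' := ⟨hz₀, e₀, he₀⟩
  let h := ContDiffAt.toOpenPartialHomeomorph Φ (f' := e₀) (hΦ.contDiffAt (hW.mem_nhds hz₀))
    (he₀ ▸ hΦd z₀ hz₀) (by simp)
  have hcoe : ∀ z, h z = Φ z := fun z => rfl
  have hz₀h : z₀ ∈ h.source := ContDiffAt.mem_toOpenPartialHomeomorph_source _ _ _
  have hS : IsOpen (h.target ∩ h.symm ⁻¹' W') := h.isOpen_inter_preimage_symm hW'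
  have hmem : Φ z₀ ∈ h.target ∩ h.symm ⁻¹' W' :=
    ⟨h.map_source hz₀h, by rw [Set.mem_preimage, ← hcoe, h.left_inv hz₀h]; exact hz₀'⟩
  -- A ball for the sup metric is a product T × J, so each fibre over t in T is the interval J,
  -- which is connected.
  obtain ⟨ε, hε, hball⟩ := Metric.isOpen_iff.1 hS _ hmem
  let T : Set E' := Metric.ball (P (f z₀)) ε
  let J : Set ℝ := Metric.ball (Q z₀) ε
  have hTJ : ∀ t ∈ T, ∀ s ∈ J, (t, s) ∈ h.target ∩ h.symm ⁻¹' W' := fun t ht s hs =>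
    hball (by rw [← ball_prod_same]; exact ⟨ht, hs⟩)
  have hsymm : ∀ t ∈ T, ∀ s ∈ J, ContDiffAt ℝ ∞ h.symm (t, s) := by
    intro t ht s hs
    obtain ⟨hm, hw, e, he⟩ := hTJ t ht s hs
    exact h.contDiffAt_symm (f₀' := e) hm (he ▸ hΦd _ hw) (hΦ.contDiffAt (hW.mem_nhds hw))
  -- Composing with P does not enlarge the kernel: if u spans ker df, then Q u ≠ 0 by invertibility,
  -- and P(df v) = 0 makes dΦ(v) a multiple of dΦ(u), so v is a multiple of u.
  have hkerP : ∀ z ∈ W', ∀ v, P (fderiv ℝ f z v) = 0 ↔ fderiv ℝ f z v = 0 := by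
    rintro z ⟨hz, e, he⟩ v
    refine ⟨fun hv => ?_, fun hv => by rw [hv, map_zero]⟩
    obtain ⟨u, hu, hspan⟩ := finrank_eq_one_iff'.1 (hker z hz)
    have he' : ∀ w, e w = (P (fderiv ℝ f z w), Q w) := fun w => DFunLike.congr_fun he w
    have hu0 : fderiv ℝ f z u = 0 := u.2
    have hQu : Q u ≠ 0 := fun h0 => hu <| Subtype.ext <| e.injective <| by
      rw [he', hu0, h0, map_zero]; simp
    have hvu : v = (Q v / Q u) • (u : E) := e.injective <| by
      rw [he', he', hv, map_smul, map_smul Q, hu0, smul_zero, map_zero, smul_eq_mul,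
        div_mul_cancel₀ _ hQu]
    rw [hvu, map_smul, hu0, smul_zero]
  -- Along a fibre P ∘ f equals the constant t, so by the previous kernel comparison f itself has
  -- zero derivative there. Thus f depends on t alone.
  have hconst : ∀ t ∈ T, ∀ s ∈ J, f (h.symm (t, s)) = f (h.symm (t, Q z₀)) := by
    intro t ht s hs
    have hd : ∀ s ∈ J, HasFDerivAt (fun s : ℝ => f (h.symm (t, s))) (0 : ℝ →L[ℝ] F) s := by
      intro s hs
      have hw := (hTJ t ht s hs).2
      have h1 : HasFDerivAt (fun s : ℝ => h.symm (t, s)) _ s :=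
        ((hsymm t ht s hs).differentiableAt (by simp)).hasFDerivAt.comp s
          (hasFDerivAt_prodMk_right t s)
      have h2 := (hfd _ hw.1).comp s h1
      have h3 : (fun s : ℝ => P (f (h.symm (t, s)))) =ᶠ[nhds s] fun _ => t := by
        filter_upwards [Metric.isOpen_ball.mem_nhds hs] with s' hs'
        exact congrArg Prod.fst (h.right_inv (hTJ t ht s' hs').1)
      have h4 := ((P.hasFDerivAt.comp s h2).congr_of_eventuallyEq h3.symm).unique
        (hasFDerivAt_const t s)
      refine h2.congr_fderiv ?_
      ext1
      exact (hkerP _ hw _).1 (DFunLike.congr_fun h4 1)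
    refine Metric.isOpen_ball.is_const_of_fderiv_eq_zero (s := J) (𝕜 := ℝ)
      (f := fun s => f (h.symm (t, s))) (convex_ball _ _).isPreconnected
      (fun s hs => (hd s hs).differentiableAt.differentiableWithinAt)
      (fun s hs => (hd s hs).fderiv) hs (Metric.mem_ball_self hε)
  have hUW : h.source ∩ Φ ⁻¹' (T ×ˢ J) ⊆ W' := by
    rintro z ⟨hz, ht, hs⟩
    have := (hTJ _ ht _ hs).2
    rwa [Set.mem_preimage, ← hcoe, h.left_inv hz] at this
  have hτd : ∀ z ∈ W, fderiv ℝ (fun z => P (f z)) z = P ∘L fderiv ℝ f z := fun z hz =>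
    (P.hasFDerivAt.comp z (hfd z hz)).fderiv
  refine ⟨h.source ∩ Φ ⁻¹' (T ×ˢ J), T, fun t => f (h.symm (t, Q z₀)), fun z => P (f z),
    h.isOpen_inter_preimage (Metric.isOpen_ball.prod Metric.isOpen_ball), ?_,
    fun z hz => (hUW hz).1, Metric.isOpen_ball, ?_, ?_, ?_, ?_, ?_, ?_⟩
  · exact ⟨hz₀h, Metric.mem_ball_self hε, Metric.mem_ball_self hε⟩
  · intro t ht
    have hs := Metric.mem_ball_self (x := Q z₀) hε
    have hw := (hTJ t ht _ hs).2
    exact ((hf.contDiffAt (hW.mem_nhds hw.1)).comp t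
      ((hsymm t ht _ hs).comp t (contDiffAt_id.prodMk contDiffAt_const))).contDiffWithinAt
  · exact P.contDiff.comp_contDiffOn (hf.mono fun z hz => (hUW hz).1)
  · refine Set.Subset.antisymm ?_ fun t ht => ?_
    · rintro _ ⟨z, hz, rfl⟩
      exact hz.2.1
    · have hs := Metric.mem_ball_self (x := Q z₀) hε
      have hm := (hTJ t ht _ hs).1
      have hr : Φ (h.symm (t, Q z₀)) = (t, Q z₀) := h.right_inv hm
      exact ⟨h.symm (t, Q z₀), ⟨h.map_target hm, by rw [Set.mem_preimage, hr]; exact ⟨ht, hs⟩⟩,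
        congrArg Prod.fst hr⟩
  · rintro z ⟨hz, ht, hs⟩
    have := hconst _ ht _ hs
    exact this.symm.trans (congrArg f (h.left_inv hz))
  · intro z hz v
    rw [hτd z (hUW hz).1]
    exact hkerP z (hUW hz) v
  · intro z hz t
    obtain ⟨hw, e, he⟩ := hUW hz
    obtain ⟨v, hv⟩ := e.surjective (t, 0)
    refine ⟨v, ?_⟩
    rw [hτd z hw]
    have he' : e v = (P (fderiv ℝ f z v), Q v) := DFunLike.congr_fun he v
    exact (congrArg Prod.fst (he'.symm.trans hv))

end ConstantRank

/-! ### The curvature sphere and its relation to a_111 -/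

section Principal

variable {n : ℕ} {M : Type*} [TopologicalSpace M]
  [ChartedSpace (EuclideanSpace ℝ (Fin (n - 1))) M]
  {X : M → ConformalSpace n} {A : M → Module.Basis (FrameIndex n) ℝ (PolyCoord n)} {O : Set M}
  {x : M} {i₁ : Fin (n - 1)}

variable (A i₁) in
/-- The coefficient `λ₁₁ / g₁₁`, in an adapted frame the eigenvalue of `λⁱⱼ` for the
eigendirection. -/
def principalCurvature (x : M) : ℝ := lam A x i₁ i₁ / g A x i₁ i₁

variable (A i₁) in
/-- The tangent hypersphere having second order contact with the hypersurface in the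
eigendirection. -/
def curvatureSphere (x : M) : PolyCoord n :=
  A x .normal + principalCurvature A i₁ x • A x .zero

variable (A i₁) in
/-- The form of the tensors `g_ij`, `λ_ij`, `a_ij` in a frame adapted to an eigendirection. -/
structure IsPrincipalAt (x : M) (L : Submodule ℝ (TangentSpace (𝓡 (n - 1)) x)) : Prop where
  g_ne_zero : g A x i₁ i₁ ≠ 0
  lam_eq : ∀ k, lam A x k i₁ = principalCurvature A i₁ x * g A x k i₁
  a2_eq : ∃ s : ℝ, ∀ k, a2 A x k i₁ = s * g A x k i₁
  mem_iff : ∀ v, v ∈ L ↔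
    lam A x *ᵥ coframe A x v = principalCurvature A i₁ x • (g A x *ᵥ coframe A x v)
  mem_iff_single : ∀ v, v ∈ L ↔ ∃ c : ℝ, coframe A x v = c • Pi.single i₁ 1

theorem mem_eigendirection_iff (hg : (g A x).det ≠ 0) (s : ℝ) (v : TangentSpace (𝓡 (n - 1)) x) :
    v ∈ eigendirection A x s ↔ a2 A x *ᵥ coframe A x v = s • (g A x *ᵥ coframe A x v) := by
  have hu : IsUnit (g A x).det := isUnit_iff_ne_zero.2 hg
  have h1 : v ∈ eigendirection A x s ↔ affinor A x *ᵥ coframe A x v = s • coframe A x v := by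
    unfold eigendirection
    rw [Submodule.mem_comap, Module.End.mem_eigenspace_iff, Matrix.toLin'_apply]
    rfl
  rw [h1, affinor]
  constructor
  · intro h
    have := congrArg (g A x *ᵥ ·) h
    simp only [Matrix.mulVec_mulVec, Matrix.mulVec_smul] at this
    rwa [Matrix.mul_nonsing_inv_cancel_left _ _ hu] at this
  · intro h
    rw [← Matrix.mulVec_mulVec, h, Matrix.mulVec_smul, Matrix.mulVec_mulVec,
      Matrix.nonsing_inv_mul _ hu, Matrix.one_mulVec]

/-- An eigenvector exists because s is a root, and adaptedness confines its coordinates to the label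
i₁. So the basis vector with that label is itself an eigenvector, and it spans the eigendirection.
-/
theorem IsFrameField.isPrincipalAt (h : IsFrameField X A O) (hX : IsHypersurface X) (hx : x ∈ O)
    {s : ℝ} (hs : (affinor A x).charpoly.IsRoot s)
    (hA : IsAdaptedAt A x (eigendirection A x s) i₁) :
    IsPrincipalAt A i₁ x (eigendirection A x s) := by
  have hg := h.det_g_ne_zero hx
  have hsingle : ∀ v ∈ eigendirection A x s, ∃ c : ℝ, coframe A x v = c • Pi.single i₁ 1 := by
    intro v hv
    refine ⟨coframe A x v i₁, funext fun p => ?_⟩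
    obtain ⟨a, b, hab⟩ := Submodule.mem_span_pair.1 (hA v hv).1
    by_cases hp : p = i₁
    · subst hp; simp
    · have hz : coframe A x v p = 0 := by
        rw [coframe_apply, ← hab]
        simp [Ne.symm hp]
      simp [hz, hp]
  obtain ⟨c₀, hc₀, hc₀'⟩ : ∃ c : Fin (n - 1) → ℝ, c ≠ 0 ∧
      (Matrix.scalar _ s - affinor A x) *ᵥ c = 0 := by
    rw [Matrix.exists_mulVec_eq_zero_iff, ← Matrix.eval_charpoly]
    exact hs
  obtain ⟨v₀, rfl⟩ := (h.coframe_bijective hX hx).2 c₀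
  have hv₀ : v₀ ∈ eigendirection A x s := by
    unfold eigendirection
    rw [Submodule.mem_comap, Module.End.mem_eigenspace_iff, Matrix.toLin'_apply]
    rw [Matrix.sub_mulVec, sub_eq_zero] at hc₀'
    have hsc : ∀ c : Fin (n - 1) → ℝ, Matrix.scalar _ s *ᵥ c = s • c := fun c => by
      ext k; simp [Matrix.mulVec_diagonal]
    rw [hsc] at hc₀'
    exact hc₀'.symm
  obtain ⟨c, hc⟩ := hsingle v₀ hv₀
  have hc0 : c ≠ 0 := by
    rintro rfl
    exact hc₀ (by rw [hc, zero_smul])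
  have hcol := (mem_eigendirection_iff hg s v₀).1 hv₀
  rw [hc, Matrix.mulVec_smul, Matrix.mulVec_smul, smul_comm s] at hcol
  have hcol' := smul_right_injective _ hc0 hcol
  have ha2 : ∀ k, a2 A x k i₁ = s * g A x k i₁ := fun k => by
    simpa using congrFun hcol' k
  -- The tangency half of adaptedness makes the column i₁ of g diagonal; the nondegeneracy of g then
  -- gives g_11 ≠ 0.
  have hoff : ∀ p, p ≠ i₁ → g A x p i₁ = 0 := by
    intro p hp
    have := (hA v₀ hv₀).2 p hp
    rw [h.form_diff_zero_tan hx, hc, Matrix.mulVec_smul] at this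
    simpa [hc0] using this
  have hg1 : g A x i₁ i₁ ≠ 0 := by
    intro h0
    refine hg (Matrix.exists_mulVec_eq_zero_iff.1 ⟨Pi.single i₁ 1, by simp, funext fun p => ?_⟩)
    by_cases hp : p = i₁
    · subst hp; simpa using h0
    · simpa using hoff p hp
  have hlam : ∀ k, lam A x k i₁ = (s + lamMean A x) * g A x k i₁ := by
    intro k
    have := ha2 k
    rw [a2, Matrix.sub_apply, Matrix.smul_apply, smul_eq_mul] at this
    linarith
  have hpc : principalCurvature A i₁ x = s + lamMean A x := by
    rw [principalCurvature, hlam, mul_div_cancel_right₀ _ hg1]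
  refine ⟨hg1, fun k => by rw [hpc, hlam], ⟨s, ha2⟩, fun v => ?_, fun v => ⟨hsingle v, ?_⟩⟩
  · rw [mem_eigendirection_iff hg, hpc, a2, Matrix.sub_mulVec, Matrix.smul_mulVec, add_smul,
      sub_eq_iff_eq_add]
  · rintro ⟨c', hc'⟩
    rw [mem_eigendirection_iff hg, hc', Matrix.mulVec_smul, Matrix.mulVec_smul, hcol', smul_comm]

namespace IsPrincipalAt

variable {L : Submodule ℝ (TangentSpace (𝓡 (n - 1)) x)}

theorem dualVec_mem (hp : IsPrincipalAt A i₁ x L) (h : IsFrameField X A O)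
    (hX : IsHypersurface X) (hx : x ∈ O) : dualVec A i₁ x ∈ L :=
  (hp.mem_iff_single _).2 ⟨1, by rw [h.coframe_dualVec hX hx, one_smul]⟩

theorem eq_smul_dualVec (hp : IsPrincipalAt A i₁ x L) (h : IsFrameField X A O)
    (hX : IsHypersurface X) (hx : x ∈ O) {v : TangentSpace (𝓡 (n - 1)) x} (hv : v ∈ L) :
    ∃ c : ℝ, v = c • dualVec A i₁ x := by
  obtain ⟨c, hc⟩ := (hp.mem_iff_single v).1 hv
  exact ⟨c, (h.coframe_bijective hX hx).1 (by rw [hc, map_smul, h.coframe_dualVec hX hx])⟩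

/-- With a_1l = s g_1l, the two symmetrized terms a_11 g_1l and g_11 a_1l coincide, so the
correction cancels whatever μ is. -/
theorem a3_eq_lam3 (hp : IsPrincipalAt A i₁ x L) (hlam : ∀ i j, lam A x i j = lam A x j i) :
    a3 A x i₁ i₁ i₁ = lam3 A x i₁ i₁ i₁ := by
  obtain ⟨s, hs⟩ := hp.a2_eq
  have hs' : ∀ l, a2 A x i₁ l = s * g A x i₁ l := by
    intro l
    rw [g_comm, ← hs, a2, Matrix.sub_apply, Matrix.sub_apply, hlam, Matrix.smul_apply,
      Matrix.smul_apply, g_comm]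
  rw [a3, add_eq_left]
  refine Finset.sum_eq_zero fun l _ => ?_
  rw [hs', hs']
  ring

end IsPrincipalAt

section Smooth

variable [IsManifold (𝓡 (n - 1)) ∞ M] {L : ∀ x : M, Submodule ℝ (TangentSpace (𝓡 (n - 1)) x)}

/-- Rodrigues' formula tested against A_1. It holds for every v, not only along L, so κ can be read
off from any direction with (dA_0(v), A_1) ≠ 0. -/
theorem form_diff_normal_eq_neg_mul (h : IsFrameField X A O) (hX : IsHypersurface X) (hx : x ∈ O)
    (hp : IsPrincipalAt A i₁ x (L x)) (v : TangentSpace (𝓡 (n - 1)) x) :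
    form (diff (fun y => A y .normal) x v) (A x (.tan i₁)) =
      -(principalCurvature A i₁ x * form (diff (fun y => A y .zero) x v) (A x (.tan i₁))) := by
  rw [h.form_diff_normal_tan hX hx, h.form_diff_zero_tan hx, Matrix.mulVec, Matrix.mulVec,
    dotProduct, dotProduct, Finset.mul_sum]
  congr 1
  refine Finset.sum_congr rfl fun j _ => ?_
  rw [h.lam_comm hX hx, hp.lam_eq, g_comm, mul_assoc]

/-- The definition of κ passes through the pointwise dual frame, whose smoothness is not evident.
Instead κ is written as -(dA_n(w), A_1) / (dA_0(w), A_1) for a vector field w with constant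
coordinates in a chart. -/
theorem contMDiffAt_principalCurvature (h : IsFrameField X A O) (hX : IsHypersurface X)
    (hx : x ∈ O) (hp : ∀ y ∈ O, IsPrincipalAt A i₁ y (L y)) :
    ContMDiffAt (𝓡 (n - 1)) 𝓘(ℝ, ℝ) ∞ (principalCurvature A i₁) x := by
  set φ := extChartAt (𝓡 (n - 1)) x with hφ
  set W := φ.target ∩ φ.symm ⁻¹' O with hWdef
  have hW : IsOpen W := isOpen_chart_preimage h.isOpen x
  have hz₀ : φ x ∈ W := ⟨mem_extChartAt_target x, by
    rw [Set.mem_preimage, hφ, extChartAt_to_inv]; exact hx⟩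
  -- With w equal to e_1 at x, the denominator is g_11 ≠ 0 there and stays nonzero nearby.
  let w := chartDiff (n := n) x x (dualVec A i₁ x)
  let N : FrameIndex n → EuclideanSpace ℝ (Fin (n - 1)) → ℝ := fun ξ z =>
    formL n (fderiv ℝ ((fun y => A y ξ) ∘ φ.symm) z w) (((fun y => A y (.tan i₁)) ∘ φ.symm) z)
  have hN : ∀ ξ, ContDiffAt ℝ ∞ (N ξ) (φ x) := by
    intro ξ
    have h1 := (contDiffOn_comp_extChartAt_symm x (h.smooth ξ)).contDiffAt (hW.mem_nhds hz₀)
    have h2 := (contDiffOn_comp_extChartAt_symm x (h.smooth (.tan i₁))).contDiffAt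
      (hW.mem_nhds hz₀)
    exact contDiffAt_bilin (formL n) ((h1.fderiv_right (m := ∞) le_rfl).clm_apply
      contDiffAt_const) h2
  have hN_eq : ∀ y ∈ φ.source ∩ O, ∀ v, chartDiff x y v = w → ∀ ξ,
      N ξ (φ y) = form (diff (fun y => A y ξ) y v) (A y (.tan i₁)) := by
    rintro y ⟨hy, hyO⟩ v hv ξ
    rw [diff_eq_fderiv_chart hy (h.mdifferentiableAt hyO ξ), hv]
    simp only [N, Function.comp_apply, formL_apply, ← hφ, φ.left_inv hy]
  have hxs : x ∈ φ.source := mem_extChartAt_source x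
  have hD : N .zero (φ x) ≠ 0 := by
    rw [hN_eq x ⟨hxs, hx⟩ _ rfl, h.form_diff_zero_tan hx, h.coframe_dualVec hX hx]
    simpa using (hp x hx).g_ne_zero
  have hφc : ContMDiffAt (𝓡 (n - 1)) 𝓘(ℝ, EuclideanSpace ℝ (Fin (n - 1))) ∞ φ x :=
    contMDiffAt_extChartAt
  have hq : ContMDiffAt (𝓡 (n - 1)) 𝓘(ℝ, ℝ) ∞ (fun y => -N .normal (φ y) / N .zero (φ y)) x :=
    ((hN .normal).neg.div (hN .zero) hD).comp_contMDiffAt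
      (g := fun z => -N .normal z / N .zero z) hφc
  refine hq.congr_of_eventuallyEq ?_
  have hne : ∀ᶠ y in nhds x, N .zero (φ y) ≠ 0 :=
    ((hN .zero).continuousAt.comp hφc.continuousAt).eventually_ne hD
  filter_upwards [hne, h.mem_nhds hx, extChartAt_source_mem_nhds (I := 𝓡 (n - 1)) x]
    with y hy hyO hys
  obtain ⟨v, hv⟩ := (chartDiff_bijective (n := n) hys).2 w
  rw [eq_div_iff hy, hN_eq y ⟨hys, hyO⟩ v hv, hN_eq y ⟨hys, hyO⟩ v hv,
    form_diff_normal_eq_neg_mul h hX hyO (hp y hyO), neg_neg]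

theorem contMDiffAt_curvatureSphere (h : IsFrameField X A O) (hX : IsHypersurface X)
    (hx : x ∈ O) (hp : ∀ y ∈ O, IsPrincipalAt A i₁ y (L y)) :
    ContMDiffAt (𝓡 (n - 1)) 𝓘(ℝ, PolyCoord n) ∞ (curvatureSphere A i₁) x :=
  (h.contMDiffAt hx .normal).add (contMDiffAt_bilin (ContinuousLinearMap.lsmul ℝ ℝ)
    (contMDiffAt_principalCurvature h hX hx hp) (h.contMDiffAt hx .zero))

theorem diff_curvatureSphere (h : IsFrameField X A O) (hX : IsHypersurface X)
    (hx : x ∈ O) (hp : ∀ y ∈ O, IsPrincipalAt A i₁ y (L y)) (v : TangentSpace (𝓡 (n - 1)) x) :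
    diff (curvatureSphere A i₁) x v = diff (fun y => A y .normal) x v
      + (principalCurvature A i₁ x • diff (fun y => A y .zero) x v
        + diffReal (principalCurvature A i₁) x v • A x .zero) := by
  have h1 := (contMDiffAt_principalCurvature h hX hx hp).mdifferentiableAt (by simp)
  have h0 := h.mdifferentiableAt hx .zero
  have h2 : MDifferentiableAt (𝓡 (n - 1)) 𝓘(ℝ, PolyCoord n)
      (fun y => principalCurvature A i₁ y • A y .zero) x :=
    (hasMFDerivAt_bilin (ContinuousLinearMap.lsmul ℝ ℝ) h1.hasMFDerivAt
      h0.hasMFDerivAt).mdifferentiableAt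
  rw [← diff_smul h1 h0, ← diff_add (h.mdifferentiableAt hx .normal) h2]
  rfl

theorem form_diff_curvatureSphere_normal (h : IsFrameField X A O) (hX : IsHypersurface X)
    (hx : x ∈ O) (hp : ∀ y ∈ O, IsPrincipalAt A i₁ y (L y)) (v : TangentSpace (𝓡 (n - 1)) x) :
    form (diff (curvatureSphere A i₁) x v) (A x .normal) = 0 := by
  rw [diff_curvatureSphere h hX hx hp, form_add_left, form_add_left, form_smul_left,
    form_smul_left, h.form_diff_normal_normal hx, h.tangent x hx, h.zero_normal x hx]
  simp

/-- dC is always orthogonal to A_0 and A_n; its products with all the A_j vanish exactly on L, so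
only the product with A_{n+1} remains as a condition. -/
theorem diff_curvatureSphere_eq_zero_iff (h : IsFrameField X A O) (hX : IsHypersurface X)
    (hx : x ∈ O) (hp : ∀ y ∈ O, IsPrincipalAt A i₁ y (L y)) (v : TangentSpace (𝓡 (n - 1)) x) :
    diff (curvatureSphere A i₁) x v = 0 ↔
      v ∈ L x ∧ form (diff (curvatureSphere A i₁) x v) (A x .last) = 0 := by
  have htan : ∀ j, form (diff (curvatureSphere A i₁) x v) (A x (.tan j))
      = -(lam A x *ᵥ coframe A x v) j
        + principalCurvature A i₁ x * (g A x *ᵥ coframe A x v) j := by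
    intro j
    rw [diff_curvatureSphere h hX hx hp, form_add_left, form_add_left, form_smul_left,
      form_smul_left, h.form_diff_normal_tan hX hx, h.form_diff_zero_tan hx, h.zero_tan x hx]
    simp
  have hmem : v ∈ L x ↔ ∀ j, form (diff (curvatureSphere A i₁) x v) (A x (.tan j)) = 0 := by
    rw [(hp x hx).mem_iff, funext_iff]
    refine forall_congr' fun j => ?_
    rw [htan, Pi.smul_apply, smul_eq_mul, neg_add_eq_zero]
  rw [hmem]
  constructor
  · intro h0
    rw [h0]
    exact ⟨fun j => form_zero_left _, form_zero_left _⟩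
  · rintro ⟨ht, hl⟩
    refine (h.isConformalBasis hx).eq_zero ?_ ht
      (form_diff_curvatureSphere_normal h hX hx hp v) hl
    rw [diff_curvatureSphere h hX hx hp, form_add_left, form_add_left, form_smul_left,
      form_smul_left, h.form_diff_normal_zero hx, h.form_diff_zero_zero hx, h.zero_zero x hx]
    simp

/-- Substituting λ_k1 = κ g_k1 in λ_111, the terms with ω_1^k cancel κ dg_11, which leaves g_11 (dκ
+ κ ω_0^0 + ω_n^0)(e_1). -/
theorem a3_eq (h : IsFrameField X A O) (hX : IsHypersurface X)
    (hx : x ∈ O) (hp : ∀ y ∈ O, IsPrincipalAt A i₁ y (L y)) :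
    a3 A x i₁ i₁ i₁ = -(g A x i₁ i₁
      * form (diff (curvatureSphere A i₁) x (dualVec A i₁ x)) (A x .last)) := by
  have hb := h.isConformalBasis hx
  rw [(hp x hx).a3_eq_lam3 (h.lam_comm hX hx)]
  set e := dualVec A i₁ x with he
  have hlast : form (diff (curvatureSphere A i₁) x e) (A x .last)
      = -(diffReal (principalCurvature A i₁) x e
        + principalCurvature A i₁ x * om A .zero .zero x e + om A .normal .zero x e) := by
    rw [diff_curvatureSphere h hX hx hp, form_add_left, form_add_left, form_smul_left,
      form_smul_left, hb.form_last, hb.form_last, h.zero_last x hx, om_apply, om_apply]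
    ring
  have hdg : diffReal (fun y => g A y i₁ i₁) x e
      = 2 * ∑ k, om A (.tan i₁) (.tan k) x e * g A x k i₁ := by
    have h1 := diffReal_form (h.mdifferentiableAt hx (.tan i₁)) (h.mdifferentiableAt hx (.tan i₁)) e
    rw [form_comm (A x (.tan i₁)), hb.form_tan, ← two_mul] at h1
    exact h1
  -- The relation λ_11 = κ g_11 holds on all of O, so it may be differentiated.
  have hdlam : diffReal (fun y => lam A y i₁ i₁) x e
      = principalCurvature A i₁ x * diffReal (fun y => g A y i₁ i₁) x e
        + diffReal (principalCurvature A i₁) x e * g A x i₁ i₁ := by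
    have hgd : MDifferentiableAt (𝓡 (n - 1)) 𝓘(ℝ, ℝ) (fun y => g A y i₁ i₁) x :=
      (contMDiffAt_bilin (formL n) (h.contMDiffAt hx (.tan i₁))
        (h.contMDiffAt hx (.tan i₁))).mdifferentiableAt (by simp)
    rw [← diffReal_mul ((contMDiffAt_principalCurvature h hX hx hp).mdifferentiableAt (by simp)) hgd]
    have hev : (fun y => lam A y i₁ i₁) =ᶠ[nhds x]
        fun y => principalCurvature A i₁ y * g A y i₁ i₁ := by
      filter_upwards [h.mem_nhds hx] with y hy using (hp y hy).lam_eq i₁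
    exact DFunLike.congr_fun hev.mfderiv_eq e
  have hD : lam3 A x i₁ i₁ i₁ = diffReal (fun y => lam A y i₁ i₁) x e
      - ∑ k, lam A x k i₁ * om A (.tan i₁) (.tan k) x e
      - ∑ k, lam A x i₁ k * om A (.tan i₁) (.tan k) x e
      + lam A x i₁ i₁ * om A .zero .zero x e + g A x i₁ i₁ * om A .normal .zero x e := by
    rw [lam3, Dlam, he]
    simp [_root_.sum_apply]
  have hs1 : ∑ k, lam A x k i₁ * om A (.tan i₁) (.tan k) x e
      = principalCurvature A i₁ x * ∑ k, om A (.tan i₁) (.tan k) x e * g A x k i₁ := by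
    rw [Finset.mul_sum]
    refine Finset.sum_congr rfl fun k _ => ?_
    rw [(hp x hx).lam_eq]
    ring
  have hs2 : ∑ k, lam A x i₁ k * om A (.tan i₁) (.tan k) x e
      = ∑ k, lam A x k i₁ * om A (.tan i₁) (.tan k) x e :=
    Finset.sum_congr rfl fun k _ => by rw [h.lam_comm hX hx]
  rw [hD, hs2, hs1, hdlam, hdg, hlast, (hp x hx).lam_eq]
  ring

/-- The hypersphere of curvature is stationary in the eigendirection iff `a₁₁₁ = 0`. -/
theorem a3_eq_zero_iff (h : IsFrameField X A O) (hX : IsHypersurface X)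
    (hx : x ∈ O) (hp : ∀ y ∈ O, IsPrincipalAt A i₁ y (L y)) :
    a3 A x i₁ i₁ i₁ = 0 ↔ ∀ v ∈ L x, diff (curvatureSphere A i₁) x v = 0 := by
  have he := (hp x hx).dualVec_mem h hX hx
  rw [a3_eq h hX hx hp, neg_eq_zero, mul_eq_zero, or_iff_right (hp x hx).g_ne_zero]
  have h1 := diff_curvatureSphere_eq_zero_iff h hX hx hp (dualVec A i₁ x)
  refine ⟨fun h0 v hv => ?_, fun h0 => (h1.1 (h0 _ he)).2⟩
  obtain ⟨c, rfl⟩ := (hp x hx).eq_smul_dualVec h hX hx hv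
  rw [map_smul, h1.2 ⟨he, h0⟩, smul_zero]

end Smooth

end Principal

/-! ### Envelopes and curvature spheres -/

section Canal

variable {n : ℕ} {M : Type*} [TopologicalSpace M]
  [ChartedSpace (EuclideanSpace ℝ (Fin (n - 1))) M]
  {X : M → ConformalSpace n} {A : M → Module.Basis (FrameIndex n) ℝ (PolyCoord n)} {O : Set M}
  {x : M} {i₁ : Fin (n - 1)}

/-- The hyperspheres tangent to the hypersurface belong to the pencil spanned by `Aₙ`, `A₀`. -/
theorem IsTangentSphereAt.form_eq_zero {B : PolyCoord n} (hB : IsTangentSphereAt X B x)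
    (h : IsFrameField X A O) (hX : IsHypersurface X) (hx : x ∈ O) :
    form B (A x .zero) = 0 ∧ ∀ i, form B (A x (.tan i)) = 0 := by
  obtain ⟨-, O', Y, hx', hY, h0, hd⟩ := hB
  obtain ⟨k, m, hk, hYx, hdY⟩ := h.exists_eq_smul_of_isSmoothLift hx hY hx'
  rw [hYx, form_smul_left, mul_eq_zero, or_iff_right hk, form_comm] at h0
  refine ⟨h0, fun i => ?_⟩
  have := hd (dualVec A i x)
  rw [hdY, form_add_left, form_smul_left, form_smul_left, form_comm _ B, form_comm _ B, h0,
    h.diff_zero_eq hx, form_add_right, form_smul_right, h0, form_sum_right,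
    h.coframe_dualVec hX hx] at this
  simp only [form_smul_right, Pi.single_apply] at this
  simpa [hk] using this

theorem IsTangentSphereAt.eq_add {B : PolyCoord n} (hB : IsTangentSphereAt X B x)
    (h : IsFrameField X A O) (hX : IsHypersurface X) (hx : x ∈ O) :
    B = form B (A x .normal) • A x .normal + (-form B (A x .last)) • A x .zero :=
  (h.isConformalBasis hx).eq_of_orthogonal (hB.form_eq_zero h hX hx).1
    (hB.form_eq_zero h hX hx).2

/-- Otherwise B would be a multiple of the isotropic vector A_0, against (B, B) > 0. -/
theorem IsTangentSphereAt.form_normal_ne_zero {B : PolyCoord n} (hB : IsTangentSphereAt X B x)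
    (h : IsFrameField X A O) (hX : IsHypersurface X) (hx : x ∈ O) :
    form B (A x .normal) ≠ 0 := by
  intro h0
  have h1 := hB.1
  have h2 := hB.eq_add h hX hx
  rw [h0, zero_smul, zero_add] at h2
  rw [h2, form_smul_left, form_smul_right, h.zero_zero x hx] at h1
  simp at h1

theorem form_curvatureSphere_normal (h : IsFrameField X A O) (hx : x ∈ O) :
    form (curvatureSphere A i₁ x) (A x .normal) = 1 := by
  rw [curvatureSphere, form_add_left, form_smul_left, h.normal_normal x hx, h.zero_normal x hx]
  simp

theorem form_curvatureSphere_self (h : IsFrameField X A O) (hx : x ∈ O) :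
    form (curvatureSphere A i₁ x) (curvatureSphere A i₁ x) = 1 := by
  conv_lhs => rw [curvatureSphere, form_add_left, form_smul_left, form_comm,
    ← curvatureSphere, form_curvatureSphere_normal h hx, curvatureSphere, form_add_right,
    form_smul_right, h.zero_normal x hx, h.zero_zero x hx]
  simp

theorem isTangentSphereAt_curvatureSphere (h : IsFrameField X A O) (hx : x ∈ O) :
    IsTangentSphereAt X (curvatureSphere A i₁ x) x := by
  refine ⟨by rw [form_curvatureSphere_self h hx]; exact one_pos, O, _, hx, h.isSmoothLift, ?_,
    fun v => ?_⟩
  · rw [curvatureSphere, form_add_right, form_smul_right, h.zero_normal x hx, h.zero_zero x hx]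
    simp
  · rw [curvatureSphere, form_add_right, form_smul_right, h.tangent x hx,
      h.form_diff_zero_zero hx]
    simp

variable {L : ∀ x : M, Submodule ℝ (TangentSpace (𝓡 (n - 1)) x)}

/-- A tangent hypersphere stationary in the eigendirection is the hypersphere of curvature. -/
theorem eq_smul_curvatureSphere (h : IsFrameField X A O) (hX : IsHypersurface X) (hx : x ∈ O)
    (hp : IsPrincipalAt A i₁ x (L x)) {C : M → PolyCoord n} {U : Set M} (hU : U ∈ nhds x)
    (hC : MDifferentiableAt (𝓡 (n - 1)) 𝓘(ℝ, PolyCoord n) C x)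
    (htan : ∀ y ∈ U, IsTangentSphereAt X (C y) y)
    (hstat : ∀ v ∈ L x, diff C x v = 0) :
    C x = form (C x) (A x .normal) • curvatureSphere A i₁ x := by
  have hb := h.isConformalBasis hx
  -- Write C = c A_n + t A_0. Differentiating (C, A_1) = 0 along e_1, where dC = 0, gives c λ_11 - t
  -- g_11 = 0, hence t = c κ.
  have h1 := form_diff_add_form_diff_of_const (Filter.inter_mem hU (h.mem_nhds hx)) hC
    (h.mdifferentiableAt hx (.tan i₁))
    (fun y hy => ((htan y hy.1).form_eq_zero h hX hy.2).2 i₁) (dualVec A i₁ x)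
  have h2 := form_diff_add_form_diff_of_const (h.mem_nhds hx) (h.mdifferentiableAt hx .zero)
    (h.mdifferentiableAt hx (.tan i₁)) (fun y hy => h.zero_tan y hy i₁) (dualVec A i₁ x)
  have h3 : form (A x .normal) (diff (fun y => A y (.tan i₁)) x (dualVec A i₁ x))
      = lam A x i₁ i₁ := by
    rw [form_comm, hb.form_normal]
    rfl
  have hT := (htan x (mem_of_mem_nhds hU)).eq_add h hX hx
  rw [h.form_diff_zero_tan hx, h.coframe_dualVec hX hx, Matrix.mulVec_single_one] at h2
  rw [hstat _ (hp.dualVec_mem h hX hx), form_zero_left, add_zero, hT, form_add_left,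
    form_smul_left, form_smul_left, h3, hp.lam_eq, eq_neg_of_add_eq_zero_left h2] at h1
  have h4 : -form (C x) (A x .last)
      = form (C x) (A x .normal) * principalCurvature A i₁ x := by
    refine mul_right_cancel₀ hp.g_ne_zero ?_
    simp only [Matrix.col_apply] at h1
    linarith
  conv_lhs => rw [hT, h4]
  rw [curvatureSphere, smul_add, smul_smul]

variable [IsManifold (𝓡 (n - 1)) ∞ M]

/-- Near x the enveloping spheres are c C. Along L their derivative dc C + c dC vanishes; since (C,
A_n) = 1 and (dC, A_n) = 0, pairing with A_n gives dc = 0, and c ≠ 0 then gives dC = 0. -/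
theorem diff_curvatureSphere_eq_zero_of_isOneCanal (h : IsFrameField X A O)
    (hX : IsHypersurface X) (hx : x ∈ O) (hp : ∀ y ∈ O, IsPrincipalAt A i₁ y (L y))
    (hcan : IsOneCanal X L) {v : TangentSpace (𝓡 (n - 1)) x} (hv : v ∈ L x) :
    diff (curvatureSphere A i₁) x v = 0 := by
  obtain ⟨U, T, B, τ, hxU, hB, hE⟩ := hcan x
  have hτ : ∀ y ∈ U, MDifferentiableAt (𝓡 (n - 1)) (𝓡 (n - 2)) τ y := fun y hy =>
    (hE.smooth.contMDiffAt (hE.isOpen.mem_nhds hy)).mdifferentiableAt (by simp)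
  have hBd : ∀ y ∈ U, MDifferentiableAt (𝓡 (n - 2)) 𝓘(ℝ, PolyCoord n) B (τ y) := fun y hy =>
    ((hB.smooth.contDiffAt (hB.isOpen.mem_nhds
      (hE.image ▸ Set.mem_image_of_mem τ hy))).differentiableAt (by simp)).mdifferentiableAt
  have hC : ∀ y ∈ U, MDifferentiableAt (𝓡 (n - 1)) 𝓘(ℝ, PolyCoord n) (B ∘ τ) y := fun y hy =>
    (hBd y hy).comp y (hτ y hy)
  have hstat : ∀ y ∈ U, ∀ w ∈ L y, diff (B ∘ τ) y w = 0 := by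
    intro y hy w hw
    refine (mfderiv_comp_apply y (hBd y hy) (hτ y hy) w).trans ?_
    rw [(hE.characteristic y hy w).2 hw]
    exact map_zero _
  have heq : ∀ y ∈ U ∩ O, (B ∘ τ) y = form ((B ∘ τ) y) (A y .normal) • curvatureSphere A i₁ y :=
    fun y hy => eq_smul_curvatureSphere h hX hy.2 (hp y hy.2) (hE.isOpen.mem_nhds hy.1)
      (hC y hy.1) hE.tangent (hstat y hy.1)
  have hc : MDifferentiableAt (𝓡 (n - 1)) 𝓘(ℝ, ℝ) (fun y => form ((B ∘ τ) y) (A y .normal)) x :=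
    (hasMFDerivAt_bilin (formL n) (hC x hxU).hasMFDerivAt
      (h.mdifferentiableAt hx .normal).hasMFDerivAt).mdifferentiableAt
  have hev : B ∘ τ =ᶠ[nhds x]
      fun y => form ((B ∘ τ) y) (A y .normal) • curvatureSphere A i₁ y := by
    filter_upwards [hE.isOpen.mem_nhds hxU, h.mem_nhds hx] with y hy hyO using heq y ⟨hy, hyO⟩
  have h1 : diff (B ∘ τ) x v = diff _ x v := DFunLike.congr_fun hev.mfderiv_eq v
  rw [hstat x hxU v hv, diff_smul hc
    ((contMDiffAt_curvatureSphere h hX hx hp).mdifferentiableAt (by simp))] at h1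
  have h2 := congrArg (fun V => form V (A x .normal)) h1
  simp only [form_add_left, form_smul_left, form_zero_left,
    form_diff_curvatureSphere_normal h hX hx hp, form_curvatureSphere_normal h hx, mul_zero,
    zero_add, mul_one] at h2
  rw [← h2, zero_smul, add_zero] at h1
  exact (smul_eq_zero.1 h1.symm).resolve_left ((hE.tangent x hxU).form_normal_ne_zero h hX hx)

/-- If the hyperspheres of curvature are stationary in the eigendirection, the hypersurface is
locally their envelope. -/
theorem exists_envelope (hn : 2 ≤ n) (h : IsFrameField X A O)
    (hX : IsHypersurface X) (hx : x ∈ O) (hp : ∀ y ∈ O, IsPrincipalAt A i₁ y (L y))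
    (hstat : ∀ y ∈ O, ∀ v ∈ L y, diff (curvatureSphere A i₁) y v = 0) :
    ∃ (U : Set M) (T : Set (EuclideanSpace ℝ (Fin (n - 2))))
      (B : EuclideanSpace ℝ (Fin (n - 2)) → PolyCoord n) (τ : M → EuclideanSpace ℝ (Fin (n - 2))),
      x ∈ U ∧ IsHypersphereFamily B T ∧ IsEnvelopeOn X L B T τ U := by
  set φ := extChartAt (𝓡 (n - 1)) x with hφ
  set W := φ.target ∩ φ.symm ⁻¹' O with hWdef
  set f := curvatureSphere A i₁ ∘ φ.symm with hfdef
  have hW : IsOpen W := isOpen_chart_preimage h.isOpen x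
  have hz₀ : φ x ∈ W := ⟨mem_extChartAt_target x, by
    rw [Set.mem_preimage, hφ, extChartAt_to_inv]; exact hx⟩
  have hf : ContDiffOn ℝ ∞ f W := contDiffOn_comp_extChartAt_symm x fun y hy =>
    (contMDiffAt_curvatureSphere h hX hy hp).contMDiffWithinAt
  have hdiff : ∀ y ∈ φ.source ∩ O, ∀ v, diff (curvatureSphere A i₁) y v
      = fderiv ℝ f (φ y) (chartDiff (n := n) x y v) := fun y hy v =>
    diff_eq_fderiv_chart hy.1
      ((contMDiffAt_curvatureSphere h hX hy.2 hp).mdifferentiableAt (by simp)) v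
  -- The inclusion ker dC ⊆ L is automatic; stationarity supplies the other one, so the rank of C is
  -- constant.
  have hL : ∀ y ∈ O, ∀ v, diff (curvatureSphere A i₁) y v = 0 ↔ v ∈ L y := fun y hy v =>
    ⟨fun h0 => ((diff_curvatureSphere_eq_zero_iff h hX hy hp v).1 h0).1, hstat y hy v⟩
  have hpoint : ∀ z ∈ W, ∃ y ∈ φ.source ∩ O, φ y = z := fun z hz =>
    ⟨φ.symm z, ⟨φ.map_target hz.1, hz.2⟩, φ.right_inv hz.1⟩
  have hfy : ∀ y ∈ φ.source, f (φ y) = curvatureSphere A i₁ y := fun y hy =>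
    congrArg (curvatureSphere A i₁) (φ.left_inv hy)
  have hker : ∀ z ∈ W, Module.finrank ℝ (fderiv ℝ f z).ker = 1 := by
    intro z hz
    obtain ⟨y, hy, rfl⟩ := hpoint z hz
    have hbij := chartDiff_bijective (n := n) hy.1
    have he := (hp y hy.2).dualVec_mem h hX hy.2
    refine finrank_eq_one_iff'.2 ⟨⟨chartDiff x y (dualVec A i₁ y), ?_⟩, ?_, ?_⟩
    · exact (hdiff y hy _).symm.trans ((hL y hy.2 _).2 he)
    · intro h0
      have h1 : dualVec A i₁ y = 0 := (injective_iff_map_eq_zero _).1 hbij.1 _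
        (congrArg Subtype.val h0)
      have h2 := h.coframe_dualVec hX hy.2 i₁
      rw [h1, map_zero] at h2
      simpa using congrFun h2 i₁
    · rintro ⟨w, hw⟩
      obtain ⟨v, rfl⟩ := hbij.2 w
      have hv : v ∈ L y := (hL y hy.2 v).1 ((hdiff y hy v).trans hw)
      obtain ⟨c, rfl⟩ := (hp y hy.2).eq_smul_dualVec h hX hy.2 hv
      exact ⟨c, Subtype.ext (map_smul _ _ _).symm⟩
  -- The dimension count n - 1 = (n - 2) + 1 in natural subtraction needs 2 ≤ n.
  obtain ⟨U, T, B, τ, hU, hzU, hUW, hT, hB, hτ, him, hBτ, hkerτ, hsurj⟩ :=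
    exists_factorization_of_finrank_ker_eq_one (E' := EuclideanSpace ℝ (Fin (n - 2)))
      hW hz₀ hf hker (by simp; omega)
  have hτd : ∀ z ∈ U, DifferentiableAt ℝ τ z := fun z hz =>
    (hτ.contDiffAt (hU.mem_nhds hz)).differentiableAt (by simp)
  refine ⟨φ.source ∩ φ ⁻¹' U, T, B, τ ∘ φ, ⟨mem_extChartAt_source x, hzU⟩,
    ⟨hT, hB, ?_, ?_⟩, ⟨?_, ?_, ?_, ?_, ?_⟩⟩
  · intro t ht
    obtain ⟨z, hz, rfl⟩ := him.symm ▸ ht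
    obtain ⟨y, hy, rfl⟩ := hpoint z (hUW hz)
    rw [hBτ _ hz, hfy y hy.1, form_curvatureSphere_self h hy.2]
    exact one_pos
  -- Essential parameters: lift w through τ and the chart to a tangent vector v. If dB(w) is a
  -- multiple c B, then dC(v) = c C, and pairing with A_n gives c = 0. Hence dC(v) = 0, and the
  -- equality of the kernels of τ and C gives w = 0.
  · intro t ht w hw
    obtain ⟨z, hz, rfl⟩ := him.symm ▸ ht
    obtain ⟨u, rfl⟩ := hsurj z hz w
    obtain ⟨y, hy, rfl⟩ := hpoint z (hUW hz)
    obtain ⟨v, rfl⟩ := (chartDiff_bijective (n := n) hy.1).2 u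
    have hev : f =ᶠ[nhds (φ y)] B ∘ τ := by
      filter_upwards [hU.mem_nhds hz] with z' hz' using (hBτ z' hz').symm
    have hchain : fderiv ℝ f (φ y) = fderiv ℝ B (τ (φ y)) ∘L fderiv ℝ τ (φ y) := by
      rw [hev.fderiv_eq]
      exact fderiv_comp _ ((hB.contDiffAt (hT.mem_nhds ht)).differentiableAt (by simp))
        (hτd _ hz)
    obtain ⟨c, hc⟩ := Submodule.mem_span_singleton.1 hw
    have h1 : c • curvatureSphere A i₁ y = diff (curvatureSphere A i₁) y v := by
      rw [hdiff y hy, hchain, ← hfy y hy.1, ← hBτ _ hz]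
      exact hc
    have h2 := congrArg (fun V => form V (A y .normal)) h1
    simp only [form_smul_left, form_curvatureSphere_normal h hy.2,
      form_diff_curvatureSphere_normal h hX hy.2 hp, mul_one] at h2
    rw [hkerτ _ hz, ← hdiff y hy, ← h1, h2, zero_smul]
  · exact (continuousOn_extChartAt x).isOpen_inter_preimage (isOpen_extChartAt_source x) hU
  · exact hτ.contMDiffOn.comp ((contMDiffOn_extChartAt (I := 𝓡 (n - 1)) (x := x)).mono
      fun y hy => by rw [← extChartAt_source (𝓡 (n - 1))]; exact hy.1) fun y hy => hy.2
  · rw [← him]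
    refine Set.Subset.antisymm ?_ ?_
    · rintro _ ⟨y, hy, rfl⟩
      exact ⟨φ y, hy.2, rfl⟩
    · rintro _ ⟨z, hz, rfl⟩
      obtain ⟨y, hy, rfl⟩ := hpoint z (hUW hz)
      exact ⟨y, ⟨hy.1, hz⟩, rfl⟩
  · rintro y ⟨hy, hyU⟩
    have hyO : y ∈ O := by
      have := (hUW hyU).2
      rwa [Set.mem_preimage, φ.left_inv hy] at this
    rw [Function.comp_apply, hBτ _ hyU, hfy y hy]
    exact isTangentSphereAt_curvatureSphere h hyO
  · rintro y ⟨hy, hyU⟩ v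
    have hyO : y ∈ O := by
      have := (hUW hyU).2
      rwa [Set.mem_preimage, φ.left_inv hy] at this
    have h1 : mfderiv (𝓡 (n - 1)) (𝓡 (n - 2)) (τ ∘ φ) y v
        = fderiv ℝ τ (φ y) (chartDiff (n := n) x y v) := by
      rw [mfderiv_comp_apply y (hτd _ hyU).mdifferentiableAt
        ((contMDiffAt_extChartAt' (n := ∞)
          (by rwa [hφ, extChartAt_source] at hy)).mdifferentiableAt (by simp)), mfderiv_eq_fderiv]
      rfl
    rw [h1, ← hL y hyO, hdiff y ⟨hy, hyO⟩]
    exact hkerτ _ hyU _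

end Canal

end CanalHyp

end

/-! ### The equivalence -/

open CanalHyp
theorem theorem2 {n : ℕ} (hn : 3 ≤ n) {M : Type*} [TopologicalSpace M]
    [ChartedSpace (EuclideanSpace ℝ (Fin (n - 1))) M] [IsManifold (𝓡 (n - 1)) ∞ M]
    -- the hypersurface, and a field of directions on it
    (X : M → ConformalSpace n) (hX : IsHypersurface X)
    (L : ∀ x : M, Submodule ℝ (TangentSpace (𝓡 (n - 1)) x))
    -- smooth local fields of frames, whose domains cover the hypersurface
    {ι : Type*} (O : ι → Set M) (A : ι → M → Module.Basis (FrameIndex n) ℝ (PolyCoord n))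
    (hcover : ∀ x : M, ∃ α, x ∈ O α)
    (hframe : ∀ α, IsFrameField X (A α) (O α))
    -- the tensor `a_ij` is nondegenerate, so that `a_ijk` is defined
    (hnondeg : ∀ α, ∀ x ∈ O α, (a2 (A α) x).det ≠ 0)
    -- `s₁` is a simple eigenvalue of the affinor, and `L` is its eigendirection
    (s₁ : ι → M → ℝ)
    (hsimple : ∀ α, ∀ x ∈ O α, (affinor (A α) x).charpoly.rootMultiplicity (s₁ α x) = 1)
    (hL : ∀ α, ∀ x ∈ O α, L x = eigendirection (A α) x (s₁ α x))
    -- the frames are adapted to the eigendirection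
    (i₁ : Fin (n - 1))
    (hadapted : ∀ α, ∀ x ∈ O α, IsAdaptedAt (A α) x (L x) i₁) :
    IsOneCanal X L ↔ ∀ α, ∀ x ∈ O α, a3 (A α) x i₁ i₁ i₁ = 0 := by
  have hp : ∀ α, ∀ x ∈ O α, IsPrincipalAt (A α) i₁ x (L x) := by
    intro α x hx
    have hA := hadapted α x hx
    rw [hL α x hx] at hA ⊢
    refine (hframe α).isPrincipalAt hX hx ?_ hA
    refine (Polynomial.rootMultiplicity_pos (Matrix.charpoly_monic _).ne_zero).1 ?_
    rw [hsimple α x hx]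
    exact one_pos
  constructor
  · intro hcan α x hx
    exact (a3_eq_zero_iff (hframe α) hX hx (hp α)).2 fun v hv =>
      diff_curvatureSphere_eq_zero_of_isOneCanal (hframe α) hX hx (hp α) hcan hv
  · intro h3 x
    obtain ⟨α, hx⟩ := hcover x
    -- Here a_111 = 0 is used on the whole frame domain, since constant rank is needed in a
    -- neighbourhood of x.
    exact exists_envelope (by omega) (hframe α) hX hx (hp α) fun y hy =>
      (a3_eq_zero_iff (hframe α) hX hy (hp α)).1 (h3 α y hy)
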